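/- Let $\mathcal H$ be an infinite-dimensional complex Hilbert space with Hermitian product $\langle\langle\cdot,\cdot\rangle\rangle$ and real scalar product $\langle\cdot,\cdot\rangle=\mathrm{Re}\,\langle\langle\cdot,\cdot\rangle\rangle$. Let $\mathbb S=\{\varphi\in\mathcal H:\|\varphi\|=\sqrt2\}$, a submanifold of the underlying real Hilbert space, let $\rho_\theta\varphi=e^{i\theta}\varphi$ for $\theta\in\mathbb R$, and let $[\varphi]=\{\rho_\theta\varphi:\theta\in\mathbb R\}$ be the $\mathbb S^1$-orbit of $\varphi\in\mathbb S$. Orthogonality of vectors refers to $\langle\cdot,\cdot\rangle$, and two orbits are orthogonal if every vector of the first is orthogonal to every vector of the second. Fix $k\in\{1,2,\dots,\infty\}$; "differentiable" means of class $C^k$, and a diffeomorphism $\mathbb S\to\mathbb S$ is a bijection that is of class $C^k$ together with its inverse. A diffeomorphism $\nu:\mathbb S\to\mathbb S$ is an internal equivalence if it maps every $\mathbb S^1$-orbit into itself and $\nu\circ\rho_\theta=\rho_\theta\circ\nu$ for all $\theta$. A diffeomorphism $U:\mathbb S\to\mathbb S$ is a Hilbert automorphism if $U\circ\rho_\theta=\rho_\theta\circ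 U$ for all $\theta$, $U$ maps orthogonal vectors to orthogonal vectors, and $U(\cos t\cdot\varphi+\sin t\cdot\psi)=\cos t\cdot U(\varphi)+\sin t\cdot U(\psi)$ for all orthogonal $\varphi,\psi\in\mathbb S$ and all $t\in\mathbb R$. A diffeomorphism $\Phi:\mathbb S\to\mathbb S$ is a semi-automorphism of $\mathbb S$ if $\Phi\circ\rho_\theta=\rho_\theta\circ\Phi$ for all $\theta$ and $\Phi$ maps every pair of orthogonal $\mathbb S^1$-orbits to a pair of orthogonal $\mathbb S^1$-orbits. Then: 1. The set $\Theta Aut(\mathbb S)$ of all semi-automorphisms is a group under composition. 2. There is a unique group homomorphism $\sigma:\Theta Aut(\mathbb S)\to\{1,-1\}$ such that $\sigma(\Phi)=1$ if and only if $\Phi=\Psi^2\circ\Gamma^2$ for some $\Psi,\Gamma\in\Theta Aut(\mathbb S)$. For $\Phi\in\Theta Aut(\mathbb S)$ one has $\sigma(\Phi)=1$ (respectively $\sigma(\Phi)=-1$) if and only if there is a unitary (respectively antiunitary) map $\mathcal U:\mathcal H\to\mathcal H$ such that, for every $\varphi\in\mathbb S$, $\Phi(\varphi)=c\cdot\mathcal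 U\varphi$ for some complex number $c$ with $|c|=1$ depending on $\varphi$. 3. Call a semi-automorphism $\Phi$ with $\sigma(\Phi)=1$ an automorphism of $\mathbb S$. A diffeomorphism $\Phi:\mathbb S\to\mathbb S$ is an automorphism of $\mathbb S$ if and only if $\Phi=U\circ\nu$ for some Hilbert automorphism $U$ and some internal equivalence $\nu$. 4. A diffeomorphism $\Phi:\mathbb S\to\mathbb S$ is an automorphism of $\mathbb S$ if and only if there are a unitary map $\mathcal U:\mathcal H\to\mathcal H$ and a differentiable function $h:\mathbb S\to\mathbb R$, constant on the $\mathbb S^1$-orbits, such that $\Phi(\varphi)=\mathcal U\big(e^{-ih(\varphi)}\varphi\big)$ for all $\varphi\in\mathbb S$. -/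

import Mathlib

noncomputable section

namespace HiddenPhase

variable {H : Type*} [NormedAddCommGroup H] [InnerProductSpace ℂ H]

/-- The state space `𝕊`: the sphere of radius `√2` of the Hilbert space. -/
abbrev State (H : Type*) [NormedAddCommGroup H] : Type _ :=
  Metric.sphere (0 : H) (Real.sqrt 2)

/-- The real scalar product `⟨φ, ψ⟩`, i.e. the real part of the hermitian product. -/
def realInner (φ ψ : H) : ℝ := (inner ℂ φ ψ).re

/-- The action `ρ_θ φ = e^{iθ} φ` of the circle on `𝕊`. -/
def rho (θ : ℝ) (φ : State H) : State H :=
  ⟨Complex.exp (θ * Complex.I) • (φ : H), by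
    have h := φ.2
    rw [mem_sphere_zero_iff_norm] at h ⊢
    rw [norm_smul, Complex.norm_exp_ofReal_mul_I, one_mul, h]⟩

/-- The `S¹`-orbit `[φ] = {ρ_θ φ : θ ∈ ℝ}`. -/
def orbit (φ : State H) : Set (State H) := Set.range fun θ : ℝ => rho θ φ

/-- Two subsets of `𝕊` are orthogonal if all their elements are, for the real product. -/
def OrthSets (A B : Set (State H)) : Prop :=
  ∀ a ∈ A, ∀ b ∈ B, realInner (a : H) (b : H) = 0

/-- `f` is of class `C^k` on the submanifold `𝕊` of the real Hilbert space underlying `H`: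
locally it is the restriction of a `C^k` map defined on an open subset of `H`. -/
def IsCk {F : Type*} [NormedAddCommGroup F] [NormedSpace ℝ F] (k : ℕ∞) (f : State H → F) :
    Prop :=
  ∀ φ : State H, ∃ W : Set H, IsOpen W ∧ (φ : H) ∈ W ∧
    ∃ g : H → F, ContDiffOn ℝ k g W ∧ ∀ ψ : State H, (ψ : H) ∈ W → g ψ = f ψ

/-- `Φ` is a `C^k` diffeomorphism of `𝕊`. -/
def IsDiffeo (k : ℕ∞) (Φ : Equiv.Perm (State H)) : Prop :=
  IsCk k (fun φ => (Φ φ : H)) ∧ IsCk k (fun φ => (Φ.symm φ : H))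

/-- `Φ` commutes with every `ρ_θ`. -/
def CommutesWithPhase (Φ : Equiv.Perm (State H)) : Prop :=
  ∀ (θ : ℝ) (φ : State H), Φ (rho θ φ) = rho θ (Φ φ)

/-- Internal equivalences. -/
structure IsInternalEquivalence (k : ℕ∞) (ν : Equiv.Perm (State H)) : Prop where
  diffeo : IsDiffeo k ν
  orbit_into_itself : ∀ φ : State H, ν '' orbit φ ⊆ orbit φ
  commutes : CommutesWithPhase ν

/-- Hilbert automorphisms of `𝕊`. -/
structure IsHilbertAutomorphism (k : ℕ∞) (U : Equiv.Perm (State H)) : Prop where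
  diffeo : IsDiffeo k U
  commutes : CommutesWithPhase U
  orthogonality : ∀ φ ψ : State H, realInner (φ : H) (ψ : H) = 0 →
    realInner (U φ : H) (U ψ : H) = 0
  /-- `χ` is the superposition `cos t • φ + sin t • ψ`, which lies in `𝕊` as `φ ⟂ ψ`. -/
  superposition : ∀ φ ψ : State H, realInner (φ : H) (ψ : H) = 0 → ∀ (t : ℝ) (χ : State H),
    (χ : H) = Real.cos t • (φ : H) + Real.sin t • (ψ : H) →
    (U χ : H) = Real.cos t • (U φ : H) + Real.sin t • (U ψ : H)

/-- Semi-automorphisms of `𝕊`. -/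
structure IsSemiAutomorphism (k : ℕ∞) (Φ : Equiv.Perm (State H)) : Prop where
  diffeo : IsDiffeo k Φ
  commutes : CommutesWithPhase Φ
  orthogonality : ∀ φ ψ : State H, OrthSets (orbit φ) (orbit ψ) →
    OrthSets (Φ '' orbit φ) (Φ '' orbit ψ)

/-- The property that characterizes the sign on a group `Θ` of transformations of `𝕊`:
`σ Φ = 1` exactly when `Φ = Ψ² ∘ Γ²` with `Ψ`, `Γ` in `Θ`. -/
def IsSign {Θ : Subgroup (Equiv.Perm (State H))} (σ : Θ →* ℤˣ) : Prop :=
  ∀ Φ : Θ, σ Φ = 1 ↔ ∃ Ψ Γ : Θ, Φ = Ψ ^ 2 * Γ ^ 2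

/-- Automorphisms of `𝕊`: the elements of `Θ` (the group of semi-automorphisms) of sign `1`. -/
def IsAutomorphism {Θ : Subgroup (Equiv.Perm (State H))} (σ : Θ →* ℤˣ)
    (Φ : Equiv.Perm (State H)) : Prop :=
  ∃ hΦ : Φ ∈ Θ, σ ⟨Φ, hΦ⟩ = 1

/-- Up to a phase depending on the point, `Φ` is the restriction of a unitary map. -/
def IsUnitaryType (Φ : Equiv.Perm (State H)) : Prop :=
  ∃ V : H ≃ₗᵢ[ℂ] H, ∀ φ : State H, ∃ c : ℂ, ‖c‖ = 1 ∧ (Φ φ : H) = c • V (φ : H)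

/-- Up to a phase depending on the point, `Φ` is the restriction of an antiunitary map. -/
def IsAntiunitaryType (Φ : Equiv.Perm (State H)) : Prop :=
  ∃ V : H ≃ₛₗᵢ[starRingEnd ℂ] H, ∀ φ : State H, ∃ c : ℂ, ‖c‖ = 1 ∧ (Φ φ : H) = c • V (φ : H)

end HiddenPhase

end

/-! Orbits are orthogonal for the real product exactly when their points are orthogonal for the
hermitian one, so a semi-automorphism commutes with phases and preserves hermitian orthogonality.
Let F be its extension to the whole space that is homogeneous of degree one.

The first point is that F also reflects orthogonality (`inner_eq_zero_of_homExt`), which makes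
inverses semi-automorphisms. Here differentiability enters: off the origin, F maps the complement of
x to an open subset of the complement of F x. That subset is also relatively closed, and the
punctured complement is connected, so the image is everything.

Uhlhorn's theorem (`IsOrthoMap.unitary_or_antiunitary`) then applies. In the affine chart e + x with
x orthogonal to e, F becomes additive, continuous and isometric, and it commutes or anticommutes
with i. Hence F is unitary or antiunitary up to a phase depending on the point.

The phase is a continuous circle-valued function on the sphere, so it has a continuous logarithm h
(`exists_state_lift`). In the antiunitary case, commutation with phases makes h grow by 4π along a
closed orbit, which is absurd (`not_isAntiunitaryType`). In the unitary case it makes h constant on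
orbits (`IsUnitaryType.exists_phase`).

So every semi-automorphism is a unitary map after a phase shift. Unitaries have unitary square roots
(`exists_unitary_sq_eq`) and phase shifts can be halved, so every semi-automorphism is a product of
two squares. The sign is therefore the trivial homomorphism, and automorphisms and
semi-automorphisms coincide. -/

noncomputable section

namespace HiddenPhase

variable {H : Type*} [NormedAddCommGroup H] [InnerProductSpace ℂ H]

/-! ### Phases, orbits and hermitian orthogonality -/

section Basic

@[simp] theorem State.norm_eq {E : Type*} [NormedAddCommGroup E] (φ : State E) :
    ‖(φ : E)‖ = Real.sqrt 2 :=
  mem_sphere_zero_iff_norm.1 φ.2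

theorem State.coe_ne_zero {E : Type*} [NormedAddCommGroup E] (φ : State E) : (φ : E) ≠ 0 := by
  rw [← norm_ne_zero_iff, φ.norm_eq]
  positivity

@[simp] theorem coe_rho (θ : ℝ) (φ : State H) :
    (rho θ φ : H) = Complex.exp (θ * Complex.I) • (φ : H) := rfl

@[simp] theorem rho_zero (φ : State H) : rho 0 φ = φ := by
  ext; simp

theorem exists_rho_eq {c : ℂ} (hc : ‖c‖ = 1) :
    ∃ θ : ℝ, Complex.exp (θ * Complex.I) = c :=
  (Complex.norm_eq_one_iff c).1 hc

theorem CommutesWithPhase.map_smul {Φ : Equiv.Perm (State H)} (hΦ : CommutesWithPhase Φ)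
    {c : ℂ} (hc : ‖c‖ = 1) {φ ψ : State H} (h : (ψ : H) = c • (φ : H)) :
    (Φ ψ : H) = c • (Φ φ : H) := by
  obtain ⟨θ, rfl⟩ := exists_rho_eq hc
  have : ψ = rho θ φ := Subtype.ext h
  rw [this, hΦ θ φ, coe_rho]

theorem CommutesWithPhase.mul {Φ Ψ : Equiv.Perm (State H)} (hΦ : CommutesWithPhase Φ)
    (hΨ : CommutesWithPhase Ψ) : CommutesWithPhase (Φ * Ψ) := fun θ φ => by
  rw [Equiv.Perm.mul_apply, hΨ, hΦ, Equiv.Perm.mul_apply]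

theorem CommutesWithPhase.inv {Φ : Equiv.Perm (State H)} (hΦ : CommutesWithPhase Φ) :
    CommutesWithPhase Φ⁻¹ := fun θ φ => by
  rw [Equiv.Perm.inv_eq_iff_eq, hΦ]
  exact congrArg _ (Φ.apply_symm_apply φ).symm

/-- Orbits are orthogonal for the real product iff their points are for the hermitian one. -/
theorem orthSets_orbit_iff {φ ψ : State H} :
    OrthSets (orbit φ) (orbit ψ) ↔ inner ℂ (φ : H) (ψ : H) = 0 := by
  constructor
  · intro h
    have h1 := h φ ⟨0, rho_zero φ⟩ ψ ⟨0, rho_zero ψ⟩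
    -- The point iψ of the second orbit tests the imaginary part of the hermitian product.
    have h2 := h φ ⟨0, rho_zero φ⟩ _ ⟨Real.pi / 2, rfl⟩
    have hI : Complex.exp (((Real.pi / 2 : ℝ) : ℂ) * Complex.I) = Complex.I := by
      push_cast
      exact Complex.exp_pi_div_two_mul_I
    simp only [realInner] at h1 h2
    rw [coe_rho, hI, inner_smul_right] at h2
    apply Complex.ext
    · simpa using h1
    · simpa using h2
  · rintro h _ ⟨s, rfl⟩ _ ⟨t, rfl⟩
    simp [realInner, h]

theorem CommutesWithPhase.image_orbit {Φ : Equiv.Perm (State H)} (hΦ : CommutesWithPhase Φ)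
    (φ : State H) : Φ '' orbit φ = orbit (Φ φ) := by
  simp only [orbit, ← Set.range_comp]
  congr 1
  ext θ : 1
  exact hΦ θ φ

/-- A semi-automorphism, in terms of the hermitian product. -/
theorem isSemiAutomorphism_iff {k : ℕ∞} {Φ : Equiv.Perm (State H)} :
    IsSemiAutomorphism k Φ ↔ IsDiffeo k Φ ∧ CommutesWithPhase Φ ∧
      ∀ φ ψ : State H, inner ℂ (φ : H) (ψ : H) = 0 → inner ℂ (Φ φ : H) (Φ ψ : H) = 0 := by
  constructor
  · rintro ⟨h1, h2, h3⟩
    refine ⟨h1, h2, fun φ ψ h => ?_⟩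
    have := h3 φ ψ (orthSets_orbit_iff.2 h)
    rwa [h2.image_orbit, h2.image_orbit, orthSets_orbit_iff] at this
  · rintro ⟨h1, h2, h3⟩
    refine ⟨h1, h2, fun φ ψ h => ?_⟩
    rw [h2.image_orbit, h2.image_orbit, orthSets_orbit_iff]
    exact h3 φ ψ (orthSets_orbit_iff.1 h)

end Basic

/-! ### Calculus of `C^k` maps on the sphere -/

section IsCk

variable {F G : Type*} [NormedAddCommGroup F] [NormedSpace ℝ F]
  [NormedAddCommGroup G] [NormedSpace ℝ G] {k : ℕ∞}

theorem isCk_coe_comp_contDiff {g : H → F} (hg : ContDiff ℝ k g) :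
    IsCk k (fun φ : State H => g φ) := fun _ =>
  ⟨Set.univ, isOpen_univ, trivial, g, hg.contDiffOn, fun _ _ => rfl⟩

theorem IsCk.continuous {f : State H → F} (hf : IsCk k f) : Continuous f := by
  rw [continuous_iff_continuousAt]
  intro φ
  obtain ⟨W, hW, hφ, g, hg, hgf⟩ := hf φ
  have hgc : ContinuousAt (fun ψ : State H => g ψ) φ :=
    (hg.continuousOn.continuousAt (hW.mem_nhds hφ)).comp continuousAt_subtype_val
  refine hgc.congr ?_
  filter_upwards [continuous_subtype_val.continuousAt.preimage_mem_nhds (hW.mem_nhds hφ)]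
    with ψ hψ using hgf ψ hψ

/-- Postcomposition with maps that are `C^k` near the values. -/
theorem IsCk.of_eventually_comp {f : State H → F} (hf : IsCk k f) {h : State H → G}
    (hh : ∀ φ : State H, ∃ (g : F → G) (V : Set F), IsOpen V ∧ f φ ∈ V ∧ ContDiffOn ℝ k g V ∧
      ∀ᶠ ψ in nhds φ, h ψ = g (f ψ)) : IsCk k h := fun φ => by
  obtain ⟨W, hW, hφ, f', hf', hff⟩ := hf φ
  obtain ⟨g, V, hV, hfV, hg, hev⟩ := hh φ
  obtain ⟨A, hA, hAh⟩ := (mem_nhds_induced _ _ _).1 hev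
  obtain ⟨A', hA', hA'o, hφA⟩ := mem_nhds_iff.1 hA
  refine ⟨(W ∩ f' ⁻¹' V) ∩ A', (hf'.continuousOn.isOpen_inter_preimage hW hV).inter hA'o,
    ⟨⟨hφ, ?_⟩, hφA⟩, g ∘ f', hg.comp (hf'.mono fun x hx => hx.1.1) fun x hx => hx.1.2,
    fun ψ hψ => ?_⟩
  · rw [Set.mem_preimage, hff φ hφ]
    exact hfV
  · have : h ψ = g (f ψ) := hAh (hA' hψ.2)
    rw [this, Function.comp_apply, hff ψ hψ.1.1]

theorem IsCk.contDiff_comp {g : F → G} (hg : ContDiff ℝ k g) {f : State H → F}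
    (hf : IsCk k f) : IsCk k (fun φ => g (f φ)) :=
  hf.of_eventually_comp fun _ =>
    ⟨g, Set.univ, isOpen_univ, trivial, hg.contDiffOn, Filter.Eventually.of_forall fun _ => rfl⟩

theorem IsCk.comp {f : State H → F} (hf : IsCk k f) {Φ : State H → State H}
    (hΦ : IsCk k (fun φ => (Φ φ : H))) : IsCk k (fun φ => f (Φ φ)) :=
  hΦ.of_eventually_comp fun φ => by
    obtain ⟨W, hW, hφ, g, hg, hgf⟩ := hf (Φ φ)
    refine ⟨g, W, hW, hφ, hg, ?_⟩
    filter_upwards [hΦ.continuous.continuousAt.preimage_mem_nhds (hW.mem_nhds hφ)] with ψ hψ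
    exact (hgf _ hψ).symm

theorem IsCk.prodMk {f : State H → F} {g : State H → G} (hf : IsCk k f) (hg : IsCk k g) :
    IsCk k (fun φ => (f φ, g φ)) := fun φ => by
  obtain ⟨W, hW, hφ, f', hf', hff⟩ := hf φ
  obtain ⟨W', hW', hφ', g', hg', hgg⟩ := hg φ
  exact ⟨W ∩ W', hW.inter hW', ⟨hφ, hφ'⟩, fun x => (f' x, g' x),
    (hf'.mono Set.inter_subset_left).prodMk (hg'.mono Set.inter_subset_right),
    fun ψ hψ => Prod.ext (hff ψ hψ.1) (hgg ψ hψ.2)⟩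

theorem IsDiffeo.mul {Φ Ψ : Equiv.Perm (State H)} (hΦ : IsDiffeo k Φ) (hΨ : IsDiffeo k Ψ) :
    IsDiffeo k (Φ * Ψ) :=
  ⟨hΦ.1.comp hΨ.1, hΨ.2.comp hΦ.2⟩

theorem IsDiffeo.inv {Φ : Equiv.Perm (State H)} (hΦ : IsDiffeo k Φ) : IsDiffeo k Φ⁻¹ :=
  ⟨hΦ.2, hΦ.1⟩

theorem isDiffeo_one : IsDiffeo k (1 : Equiv.Perm (State H)) :=
  ⟨isCk_coe_comp_contDiff contDiff_id, isCk_coe_comp_contDiff contDiff_id⟩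

end IsCk

/-! ### Homogeneous extension to the whole space -/

section HomExt

/-- The radial projection onto the sphere. -/
def normalize (v : H) (hv : v ≠ 0) : State H :=
  ⟨(Real.sqrt 2 / ‖v‖) • v, by
    rw [mem_sphere_zero_iff_norm, norm_smul, norm_div, norm_norm, Real.norm_of_nonneg (by simp),
      div_mul_cancel₀ _ (norm_ne_zero_iff.2 hv)]⟩

theorem coe_normalize (v : H) (hv : v ≠ 0) :
    (normalize v hv : H) = (Real.sqrt 2 / ‖v‖) • v := rfl

theorem normalize_coe (φ : State H) : normalize (φ : H) φ.coe_ne_zero = φ := by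
  ext
  rw [coe_normalize, φ.norm_eq, div_self (by simp), one_smul]

theorem inner_normalize_eq_zero_iff {v w : H} (hv : v ≠ 0) (hw : w ≠ 0) :
    inner ℂ (normalize v hv : H) (normalize w hw : H) = 0 ↔ inner ℂ v w = 0 := by
  have h1 := norm_ne_zero_iff.2 hv
  have h2 := norm_ne_zero_iff.2 hw
  rw [coe_normalize, coe_normalize, ← Complex.coe_smul, ← Complex.coe_smul, inner_smul_left,
    inner_smul_right]
  simp [h1, h2]

open Classical in
/-- The extension of a transformation of the sphere to the whole space that is homogeneous of
degree one. -/
def homExt (Φ : State H → State H) (v : H) : H :=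
  if hv : v = 0 then 0 else (‖v‖ / Real.sqrt 2) • (Φ (normalize v hv) : H)

variable {Φ : State H → State H}

theorem homExt_of_ne {v : H} (hv : v ≠ 0) :
    homExt Φ v = (‖v‖ / Real.sqrt 2) • (Φ (normalize v hv) : H) := dif_neg hv

@[simp] theorem homExt_zero : homExt Φ 0 = 0 := dif_pos rfl

@[simp] theorem homExt_coe (φ : State H) : homExt Φ φ = Φ φ := by
  rw [homExt_of_ne φ.coe_ne_zero, normalize_coe, φ.norm_eq, div_self (by simp), one_smul]

@[simp] theorem norm_homExt (v : H) : ‖homExt Φ v‖ = ‖v‖ := by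
  by_cases hv : v = 0
  · simp [hv]
  · rw [homExt_of_ne hv, norm_smul, State.norm_eq, norm_div, norm_norm,
      Real.norm_of_nonneg (by simp), div_mul_cancel₀ _ (by simp)]

theorem homExt_eq_zero_iff {v : H} : homExt Φ v = 0 ↔ v = 0 := by
  rw [← norm_eq_zero, norm_homExt, norm_eq_zero]

theorem normalize_homExt {v : H} (hv : v ≠ 0) (h : homExt Φ v ≠ 0) :
    normalize (homExt Φ v) h = Φ (normalize v hv) := by
  have := norm_ne_zero_iff.2 hv
  ext
  rw [coe_normalize, norm_homExt, homExt_of_ne hv, smul_smul]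
  convert one_smul ℝ _
  field_simp

theorem homExt_comp {Ψ : State H → State H} (v : H) :
    homExt Φ (homExt Ψ v) = homExt (Φ ∘ Ψ) v := by
  by_cases hv : v = 0
  · simp [hv]
  · have h : homExt Ψ v ≠ 0 := mt homExt_eq_zero_iff.1 hv
    rw [homExt_of_ne h, normalize_homExt hv, norm_homExt, homExt_of_ne hv]
    rfl

theorem homExt_id (v : H) : homExt (id : State H → State H) v = v := by
  by_cases hv : v = 0
  · simp [hv]
  · have := norm_ne_zero_iff.2 hv
    rw [homExt_of_ne hv, id, coe_normalize, smul_smul]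
    convert one_smul ℝ _
    field_simp

theorem homExt_smul {Φ : Equiv.Perm (State H)} (hΦ : CommutesWithPhase Φ) (c : ℂ) (v : H) :
    homExt Φ (c • v) = c • homExt Φ v := by
  by_cases hc : c = 0
  · simp [hc]
  by_cases hv : v = 0
  · simp [hv]
  have hcv : c • v ≠ 0 := smul_ne_zero hc hv
  have hc' := norm_ne_zero_iff.2 hc
  have hv' := norm_ne_zero_iff.2 hv
  have key : (Φ (normalize (c • v) hcv) : H) = (c / ‖c‖) • (Φ (normalize v hv) : H) := by
    refine hΦ.map_smul (by simp [hc]) ?_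
    rw [coe_normalize, coe_normalize, norm_smul, ← Complex.coe_smul, ← Complex.coe_smul, smul_smul,
      smul_smul]
    congr 1
    push_cast
    field_simp
  rw [homExt_of_ne hcv, homExt_of_ne hv, key, norm_smul, ← Complex.coe_smul, ← Complex.coe_smul,
    smul_smul, smul_smul]
  congr 1
  have : (‖c‖ : ℂ) ≠ 0 := by exact_mod_cast hc'
  push_cast
  field_simp

theorem inner_homExt_eq_zero
    (hΦ : ∀ φ ψ : State H, inner ℂ (φ : H) (ψ : H) = 0 → inner ℂ (Φ φ : H) (Φ ψ : H) = 0)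
    {v w : H} (h : inner ℂ v w = 0) : inner ℂ (homExt Φ v) (homExt Φ w) = 0 := by
  by_cases hv : v = 0
  · simp [hv]
  by_cases hw : w = 0
  · simp [hw]
  rw [← inner_normalize_eq_zero_iff (mt homExt_eq_zero_iff.1 hv) (mt homExt_eq_zero_iff.1 hw),
    normalize_homExt hv, normalize_homExt hw]
  exact hΦ _ _ ((inner_normalize_eq_zero_iff hv hw).2 h)

theorem contDiffOn_radial (k : ℕ∞) :
    ContDiffOn ℝ k (fun v : H => (Real.sqrt 2 / ‖v‖) • v) {0}ᶜ := by
  let _ : InnerProductSpace ℝ H := InnerProductSpace.rclikeToReal ℂ H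
  have h0 : ∀ v ∈ ({0}ᶜ : Set H), id v ≠ 0 := fun v hv => hv
  exact (contDiffOn_const.div (contDiffOn_id.norm ℝ h0)
    fun v hv => norm_ne_zero_iff.2 (h0 v hv)).smul contDiffOn_id

theorem contDiffOn_homExt {k : ℕ∞} (hΦ : IsCk k (fun φ => (Φ φ : H))) :
    ContDiffOn ℝ k (homExt Φ) {0}ᶜ := by
  let _ : InnerProductSpace ℝ H := InnerProductSpace.rclikeToReal ℂ H
  intro v hv
  have hr : ContinuousOn (fun v : H => (Real.sqrt 2 / ‖v‖) • v) {0}ᶜ :=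
    (contDiffOn_radial (H := H) 0).continuousOn
  obtain ⟨W, hW, hφ, g, hg, hgf⟩ := hΦ (normalize v hv)
  have hO := hr.isOpen_inter_preimage isOpen_compl_singleton hW
  have hmem : v ∈ ({0}ᶜ : Set H) ∩ (fun v : H => (Real.sqrt 2 / ‖v‖) • v) ⁻¹' W := ⟨hv, hφ⟩
  have h1 : ContDiffOn ℝ k (fun v : H => (‖v‖ / Real.sqrt 2) • g ((Real.sqrt 2 / ‖v‖) • v))
      (({0}ᶜ : Set H) ∩ (fun v : H => (Real.sqrt 2 / ‖v‖) • v) ⁻¹' W) :=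
    ((contDiffOn_id.norm ℝ fun v hv => hv.1).div_const _).smul
      (hg.comp ((contDiffOn_radial k).mono Set.inter_subset_left) fun v hv => hv.2)
  refine (ContDiffAt.congr_of_eventuallyEq (h1.contDiffAt (hO.mem_nhds hmem)) ?_).contDiffWithinAt
  filter_upwards [hO.mem_nhds hmem] with w hw
  rw [homExt_of_ne hw.1]
  exact congrArg _ (hgf (normalize w hw.1) hw.2).symm

end HomExt

/-! ### Orthogonality is reflected: openness and connectedness -/

section InverseOrthogonality

/-- An invertible real-linear map that sends the orthogonal complement of `x` into the one of `y`
sends it onto. -/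
theorem inner_eq_zero_of_map_inner_eq_zero {D : H →L[ℝ] H} (hD : Function.Surjective D) {x y : H}
    (hx : x ≠ 0) (hy : y ≠ 0) (h : ∀ v, inner ℂ x v = 0 → inner ℂ y (D v) = 0) {v : H}
    (hv : inner ℂ y (D v) = 0) : inner ℂ x v = 0 := by
  have hxx : inner ℂ x x ≠ 0 := inner_self_ne_zero.2 hx
  -- L' vanishes on the complement of x, so it factors through the coordinate along x as a
  -- real-linear A : ℂ → ℂ. Being surjective in finite dimension, A is injective.
  let L' : H →ₗ[ℝ] ℂ := ((innerSL ℂ y).toLinearMap.restrictScalars ℝ) ∘ₗ D.toLinearMap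
  let A : ℂ →ₗ[ℝ] ℂ := L' ∘ₗ ((LinearMap.toSpanSingleton ℂ H x).restrictScalars ℝ)
  have hA : ∀ w, L' w = A (inner ℂ x w / inner ℂ x x) := fun w => by
    have h1 : inner ℂ x (w - (inner ℂ x w / inner ℂ x x) • x) = 0 := by
      rw [inner_sub_right, inner_smul_right, div_mul_cancel₀ _ hxx, sub_self]
    have h2 : L' (w - (inner ℂ x w / inner ℂ x x) • x) = 0 := h _ h1
    rw [map_sub, sub_eq_zero] at h2
    exact h2
  have hAs : Function.Surjective A := fun c => by
    obtain ⟨w, hw⟩ := hD ((c / inner ℂ y y) • y)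
    refine ⟨inner ℂ x w / inner ℂ x x, ?_⟩
    rw [← hA]
    change inner ℂ y (D w) = c
    rw [hw, inner_smul_right, div_mul_cancel₀ _ (inner_self_ne_zero.2 hy)]
  have hAi : Function.Injective A := LinearMap.injective_iff_surjective.2 hAs
  have h3 : A (inner ℂ x v / inner ℂ x x) = A 0 := by
    rw [← hA, map_zero]
    exact hv
  have := hAi h3
  exact (div_eq_zero_iff.1 this).resolve_right hxx

theorem not_finiteDimensional_orthogonal (hH : ¬ FiniteDimensional ℂ H) (S : Submodule ℂ H)
    [FiniteDimensional ℂ S] : ¬ FiniteDimensional ℂ Sᗮ := fun h => by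
  have h1 : FiniteDimensional ℂ (S ⊔ Sᗮ : Submodule ℂ H) := inferInstance
  rw [Submodule.sup_orthogonal_of_hasOrthogonalProjection] at h1
  exact hH (Module.Finite.equiv (Submodule.topEquiv (R := ℂ) (M := H)))

theorem exists_ne_zero_mem_orthogonal (hH : ¬ FiniteDimensional ℂ H) (S : Submodule ℂ H)
    [FiniteDimensional ℂ S] : ∃ z ∈ Sᗮ, z ≠ 0 := by
  by_contra! h
  have : Sᗮ = ⊥ := (Submodule.eq_bot_iff _).2 h
  refine not_finiteDimensional_orthogonal hH S ?_
  rw [this]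
  infer_instance

theorem one_lt_rank_orthogonal (hH : ¬ FiniteDimensional ℂ H) (S : Submodule ℂ H)
    [FiniteDimensional ℂ S] : 1 < Module.rank ℝ Sᗮ := by
  by_contra! h
  have h1 : Module.Finite ℝ Sᗮ :=
    Module.rank_lt_aleph0_iff.1 (h.trans_lt Cardinal.one_lt_aleph0)
  exact not_finiteDimensional_orthogonal hH S (Module.Finite.of_restrictScalars_finite ℝ ℂ _)

/-- F sends K, the complement of x, into K', the complement of F x, and the claim is that it fills
K'. Off the origin its derivative maps K onto K', so the image is open. It is also relatively
closed, being cut out by the condition that the inverse G is orthogonal to x. The punctured K' is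
connected, so the nonempty image is all of it. -/
theorem inner_eq_zero_of_homExt [CompleteSpace H] (hH : ¬ FiniteDimensional ℂ H) {k : ℕ∞}
    (hk : 1 ≤ k) {Φ : Equiv.Perm (State H)} (hd : IsDiffeo k Φ)
    (ho : ∀ φ ψ : State H, inner ℂ (φ : H) (ψ : H) = 0 → inner ℂ (Φ φ : H) (Φ ψ : H) = 0)
    {x w : H} (hx : x ≠ 0) (h : inner ℂ (homExt Φ x) (homExt Φ w) = 0) : inner ℂ x w = 0 := by
  set F := homExt Φ with hF
  set G := homExt Φ.symm with hG
  have hGF : ∀ v, G (F v) = v := fun v => by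
    rw [hF, hG, homExt_comp, Equiv.symm_comp_self, homExt_id]
  have hFG : ∀ v, F (G v) = v := fun v => by
    rw [hF, hG, homExt_comp, Equiv.self_comp_symm, homExt_id]
  have hF0 : ∀ {v}, F v = 0 ↔ v = 0 := homExt_eq_zero_iff
  have hG0 : ∀ {v}, G v = 0 ↔ v = 0 := homExt_eq_zero_iff
  have hFd : ContDiffOn ℝ k F {0}ᶜ := contDiffOn_homExt hd.1
  have hGd : ContDiffOn ℝ k G {0}ᶜ := contDiffOn_homExt hd.2
  have hk' : (k : WithTop ℕ∞) ≠ 0 := by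
    have : k ≠ 0 := by
      rintro rfl
      simp at hk
    exact_mod_cast this
  have hopen : IsOpen ({0}ᶜ : Set H) := isOpen_compl_singleton
  let K := (ℂ ∙ x)ᗮ
  let K' := (ℂ ∙ F x)ᗮ
  have hK : ∀ {v}, v ∈ K ↔ inner ℂ x v = 0 := Submodule.mem_orthogonal_singleton_iff_inner_right
  have hK' : ∀ {v}, v ∈ K' ↔ inner ℂ (F x) v = 0 :=
    Submodule.mem_orthogonal_singleton_iff_inner_right
  have hFK : ∀ v : K, F v ∈ K' := fun v => hK'.2 (inner_homExt_eq_zero ho (hK.1 v.2))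
  let f : K → K' := fun v => ⟨F v, hFK v⟩
  -- the image of `K` is open off the origin
  have key : ∀ v : K, (v : H) ≠ 0 → Filter.map f (nhds v) = nhds (f v) := by
    intro v hv
    have h1 : HasStrictFDerivAt F (fderiv ℝ F v) (v : H) :=
      (hFd.contDiffAt (hopen.mem_nhds hv)).hasStrictFDerivAt hk'
    have h2 : HasFDerivAt G (fderiv ℝ G (F v)) (F v) :=
      ((hGd.contDiffAt (hopen.mem_nhds (mt hF0.1 hv))).differentiableAt hk').hasFDerivAt
    have h1' : HasFDerivAt F (fderiv ℝ F v) (G (F v)) := by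
      rw [hGF]; exact h1.hasFDerivAt
    -- The chain rule for F ∘ G = id makes the derivative of F surjective.
    have h3 : (fderiv ℝ F v).comp (fderiv ℝ G (F v)) = ContinuousLinearMap.id ℝ H := by
      have h4 := h1'.comp (F v) h2
      have h5 : F ∘ G = id := funext hFG
      rw [h5] at h4
      exact h4.unique (hasFDerivAt_id _)
    have hsurj : Function.Surjective (fderiv ℝ F v) := fun w =>
      ⟨fderiv ℝ G (F v) w, DFunLike.congr_fun h3 w⟩
    let i : K →L[ℝ] H := K.subtypeL.restrictScalars ℝ
    have hi : HasStrictFDerivAt (fun u : K => F u) ((fderiv ℝ F v).comp i) v :=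
      HasStrictFDerivAt.comp v (g := F) (f := fun u : K => (u : H)) h1 i.hasStrictFDerivAt
    -- Differentiate the identity ⟨F x, F u⟩ = 0, valid for all u in K.
    have hmap : ∀ w, inner ℂ x w = 0 → inner ℂ (F x) (fderiv ℝ F v w) = 0 := by
      intro w hw
      let L : H →L[ℝ] ℂ := (innerSL ℂ (F x)).restrictScalars ℝ
      have h4 : HasFDerivAt (fun u : K => L (F u)) (L.comp ((fderiv ℝ F v).comp i)) v :=
        L.hasFDerivAt.comp v hi.hasFDerivAt
      have h5 : (fun u : K => L (F u)) = fun _ => 0 := funext fun u => hK'.1 (hFK u)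
      rw [h5] at h4
      have h6 := h4.unique (hasFDerivAt_const (0 : ℂ) v)
      exact DFunLike.congr_fun h6 (⟨w, hK.2 hw⟩ : K)
    -- Composing with the projection onto K' leaves f unchanged and gives it a derivative with
    -- values in K'.
    let P : H →L[ℝ] K' := K'.orthogonalProjectionOnto.restrictScalars ℝ
    have hP : ∀ u : K', P u = u := fun u => K'.orthogonalProjectionOnto_mem_subspace_eq_self u
    have hf : f = fun u : K => P (F u) := funext fun u => (hP (f u)).symm
    have h7 : HasStrictFDerivAt f (P.comp ((fderiv ℝ F v).comp i)) v := by
      rw [hf]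
      exact P.hasStrictFDerivAt.comp v hi
    refine h7.map_nhds_eq_of_surj (LinearMap.range_eq_top.2 fun w => ?_)
    obtain ⟨u, hu⟩ := hsurj w
    refine ⟨⟨u, hK.2 (inner_eq_zero_of_map_inner_eq_zero hsurj hx (mt hF0.1 hx) hmap ?_)⟩, ?_⟩
    · rw [hu]
      exact hK'.1 w.2
    · change P (fderiv ℝ F v u) = w
      rw [hu, hP]
  have hconn : IsPreconnected ({0}ᶜ : Set K') :=
    (isConnected_compl_singleton_of_one_lt_rank (one_lt_rank_orthogonal hH _) 0).isPreconnected
  have hGc : ContinuousOn (fun w : K' => inner ℂ x (G w)) {0}ᶜ :=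
    continuousOn_const.inner (𝕜 := ℂ) (hGd.continuousOn.comp continuous_subtype_val.continuousOn
      fun w hw => fun h0 => hw (Subtype.ext h0))
  -- A₁ is the punctured image of K, open by `key`; A₂ is the rest, open by continuity of G.
  let A₁ : Set K' := {0}ᶜ ∩ {w | inner ℂ x (G w) = 0}
  let A₂ : Set K' := {0}ᶜ ∩ {w | inner ℂ x (G w) ≠ 0}
  have hA₁ : IsOpen A₁ := by
    rw [isOpen_iff_mem_nhds]
    rintro w ⟨hw0, hw⟩
    have hv : f ⟨G w, hK.2 hw⟩ = w := Subtype.ext (hFG w)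
    have hGw : G w ≠ 0 := fun h0 => hw0 (Subtype.ext (hG0.1 h0))
    have h8 := key ⟨G w, hK.2 hw⟩ hGw
    rw [hv] at h8
    refine Filter.inter_mem (isOpen_compl_singleton.mem_nhds hw0) ?_
    rw [← h8, Filter.mem_map]
    refine Filter.univ_mem' fun u => ?_
    change inner ℂ x (G (F u)) = 0
    rw [hGF]
    exact hK.1 u.2
  have hA₂ : IsOpen A₂ := hGc.isOpen_inter_preimage isOpen_compl_singleton
    (isOpen_compl_singleton (x := (0 : ℂ)))
  have hne : (({0}ᶜ : Set K') ∩ A₁).Nonempty := by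
    obtain ⟨z, hz, hz0⟩ := exists_ne_zero_mem_orthogonal hH (ℂ ∙ x)
    have h9 : f ⟨z, hz⟩ ≠ 0 := fun h0 => hz0 (hF0.1 (congrArg Subtype.val h0))
    refine ⟨f ⟨z, hz⟩, h9, h9, ?_⟩
    change inner ℂ x (G (F z)) = 0
    rw [hGF]
    exact hK.1 hz
  have hsub : ({0}ᶜ : Set K') ⊆ A₁ :=
    hconn.subset_left_of_subset_union hA₁ hA₂
      (Set.disjoint_left.2 fun w h1 h2 => h2.2 h1.2)
      (fun w hw => by
        by_cases h0 : inner ℂ x (G w) = 0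
        · exact Or.inl ⟨hw, h0⟩
        · exact Or.inr ⟨hw, h0⟩) hne
  by_cases hw : w = 0
  · simp [hw]
  have h10 := (hsub (a := ⟨F w, hK'.2 h⟩) fun h0 => hw (hF0.1 (congrArg Subtype.val h0))).2
  change inner ℂ x (G (F w)) = 0 at h10
  rwa [hGF] at h10

/-- The inverse of a semi-automorphism is one. -/
theorem IsSemiAutomorphism.inv [CompleteSpace H] (hH : ¬ FiniteDimensional ℂ H) {k : ℕ∞}
    (hk : 1 ≤ k) {Φ : Equiv.Perm (State H)} (hΦ : IsSemiAutomorphism k Φ) :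
    IsSemiAutomorphism k Φ⁻¹ := by
  obtain ⟨hd, hc, ho⟩ := isSemiAutomorphism_iff.1 hΦ
  refine isSemiAutomorphism_iff.2 ⟨hd.inv, hc.inv, fun φ ψ h => ?_⟩
  change inner ℂ (Φ.symm φ : H) (Φ.symm ψ : H) = 0
  refine inner_eq_zero_of_homExt hH hk hd ho (Φ.symm φ).coe_ne_zero (w := (Φ.symm ψ : H)) ?_
  rw [homExt_coe, homExt_coe, Φ.apply_symm_apply, Φ.apply_symm_apply]
  exact h

end InverseOrthogonality

/-! ### Uhlhorn's theorem in an affine chart -/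

section Uhlhorn

/-- Homogeneous norm-preserving surjections that preserve orthogonality in both directions. -/
structure IsOrthoMap (F : H → H) : Prop where
  continuousOn : ContinuousOn F {0}ᶜ
  map_smul : ∀ (c : ℂ) (v : H), F (c • v) = c • F v
  norm_map : ∀ v, ‖F v‖ = ‖v‖
  inner_eq_zero_iff : ∀ v w, inner ℂ (F v) (F w) = 0 ↔ inner ℂ v w = 0
  surjective : Function.Surjective F

namespace IsOrthoMap

variable {F : H → H}

theorem map_eq_zero_iff (hF : IsOrthoMap F) {v : H} : F v = 0 ↔ v = 0 := by
  rw [← norm_eq_zero, hF.norm_map, norm_eq_zero]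

/-- By surjectivity, a vector orthogonal to F x and F y is F w with w orthogonal to x and y. So the
left side lies in the double orthogonal complement of a finite-dimensional span, which is the span
itself. -/
theorem exists_map_lincomb (hF : IsOrthoMap F) (x y : H) (s t : ℂ) :
    ∃ a b : ℂ, F (s • x + t • y) = a • F x + b • F y := by
  have h : F (s • x + t • y) ∈ (Submodule.span ℂ {F x, F y})ᗮᗮ := by
    rw [Submodule.mem_orthogonal]
    intro u hu
    obtain ⟨w, rfl⟩ := hF.surjective u
    rw [Submodule.mem_orthogonal'] at hu
    have h1 := (hF.inner_eq_zero_iff _ _).1 (hu (F x) (Submodule.subset_span (by simp)))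
    have h2 := (hF.inner_eq_zero_iff _ _).1 (hu (F y) (Submodule.subset_span (by simp)))
    rw [hF.inner_eq_zero_iff, inner_add_right, inner_smul_right, inner_smul_right, h1, h2]
    simp
  have : FiniteDimensional ℂ (Submodule.span ℂ {F x, F y}) :=
    FiniteDimensional.span_of_finite ℂ (Set.toFinite _)
  rw [Submodule.orthogonal_orthogonal, Submodule.mem_span_pair] at h
  obtain ⟨a, b, hab⟩ := h
  exact ⟨a, b, hab.symm⟩

/-- The component of y orthogonal to x is orthogonal to y as well, because F y is proportional to F
x. Hence it is orthogonal to itself. -/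
theorem exists_eq_smul (hF : IsOrthoMap F) {x y : H} (hx : x ≠ 0) {c : ℂ} (h : F y = c • F x) :
    ∃ c : ℂ, y = c • x := by
  refine ⟨inner ℂ x y / inner ℂ x x, ?_⟩
  set d := inner ℂ x y / inner ℂ x x with hd
  have h1 : inner ℂ (y - d • x) x = 0 := by
    rw [inner_eq_zero_symm, inner_sub_right, inner_smul_right, hd,
      div_mul_cancel₀ _ (inner_self_ne_zero.2 hx), sub_self]
  have h2 : inner ℂ (y - d • x) y = 0 := by
    rw [← hF.inner_eq_zero_iff, h, inner_smul_right, (hF.inner_eq_zero_iff _ _).2 h1, mul_zero]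
  have h3 : inner ℂ (y - d • x) (y - d • x) = 0 := by
    rw [inner_sub_right, inner_smul_right, h1, h2, mul_zero, sub_zero]
  exact sub_eq_zero.1 (inner_self_eq_zero.1 h3)

end IsOrthoMap

/-- The expression of `F` in the affine chart given by the vectors `e + x` with `x ⟂ e`. -/
def chart (F : H → H) (e x : H) : H := (inner ℂ (F e) (F (e + x)))⁻¹ • F (e + x) - F e

namespace IsOrthoMap

variable {F : H → H} {e : H}

theorem inner_self_eq_one (hF : IsOrthoMap F) (he : ‖e‖ = 1) : inner ℂ (F e) (F e) = 1 := by
  rw [inner_self_eq_norm_sq_to_K, hF.norm_map, he]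
  simp

theorem inner_add_ne_zero (hF : IsOrthoMap F) (he : ‖e‖ = 1)
    {x : H} (hx : inner ℂ e x = 0) : inner ℂ (F e) (F (e + x)) ≠ 0 := by
  rw [Ne, hF.inner_eq_zero_iff, inner_add_right, hx, inner_self_eq_norm_sq_to_K, he]
  simp

theorem map_add_eq (hF : IsOrthoMap F) (he : ‖e‖ = 1) {x : H} (hx : inner ℂ e x = 0) :
    F (e + x) = inner ℂ (F e) (F (e + x)) • (F e + chart F e x) := by
  rw [chart, add_sub_cancel, smul_inv_smul₀ (hF.inner_add_ne_zero he hx)]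

theorem inner_chart (hF : IsOrthoMap F) (he : ‖e‖ = 1)
    {x : H} (hx : inner ℂ e x = 0) : inner ℂ (F e) (chart F e x) = 0 := by
  rw [chart, inner_sub_right, inner_smul_right, hF.inner_self_eq_one he,
    inv_mul_cancel₀ (hF.inner_add_ne_zero he hx), sub_self]

theorem chart_zero (hF : IsOrthoMap F) (he : ‖e‖ = 1) : chart F e 0 = 0 := by
  rw [chart, add_zero, hF.inner_self_eq_one he, inv_one, one_smul, sub_self]

/-- Since x = (e + x) - e, its image lies in the span of F (e + x) and F e; orthogonality to F e
leaves only the direction of the chart. -/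
theorem exists_map_eq_smul_chart (hF : IsOrthoMap F) (he : ‖e‖ = 1) {x : H} (hx : inner ℂ e x = 0) :
    ∃ c : ℂ, F x = c • chart F e x := by
  obtain ⟨p, q, h⟩ := hF.exists_map_lincomb (e + x) e 1 (-1)
  have h0 : (1 : ℂ) • (e + x) + (-1 : ℂ) • e = x := by module
  rw [h0, hF.map_add_eq he hx] at h
  have h1 : inner ℂ (F e) (F x) = 0 := (hF.inner_eq_zero_iff _ _).2 hx
  rw [h, inner_add_right, inner_smul_right, inner_smul_right, inner_smul_right, inner_add_right,
    hF.inner_chart he hx, hF.inner_self_eq_one he, add_zero, mul_one, mul_one] at h1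
  refine ⟨p * inner ℂ (F e) (F (e + x)), ?_⟩
  rw [h, eq_neg_of_add_eq_zero_right h1]
  module

theorem exists_chart_eq_smul_map (hF : IsOrthoMap F) (he : ‖e‖ = 1) {x : H} (hx : inner ℂ e x = 0) :
    ∃ c : ℂ, chart F e x = c • F x := by
  by_cases h0 : x = 0
  · exact ⟨0, by rw [h0, hF.chart_zero he, zero_smul]⟩
  obtain ⟨c, hc⟩ := hF.exists_map_eq_smul_chart he hx
  refine ⟨c⁻¹, ?_⟩
  rw [hc, inv_smul_smul₀]
  rintro rfl
  rw [zero_smul, hF.map_eq_zero_iff] at hc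
  exact h0 hc

/-- F (e + x + y) is a combination of F (e + x) and F y. Normalizing its F e component to 1 fixes
the coefficient of the chart at x to be 1. -/
theorem exists_chart_add_eq (hF : IsOrthoMap F) (he : ‖e‖ = 1)
    {x y : H} (hx : inner ℂ e x = 0) (hy : inner ℂ e y = 0) :
    ∃ s : ℂ, chart F e (x + y) = chart F e x + s • chart F e y := by
  have hxy : inner ℂ e (x + y) = 0 := by rw [inner_add_right, hx, hy, add_zero]
  obtain ⟨p, q, h⟩ := hF.exists_map_lincomb (e + x) y 1 1
  obtain ⟨c, hc⟩ := hF.exists_map_eq_smul_chart he hy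
  rw [one_smul, one_smul, add_assoc, hF.map_add_eq he hx, hF.map_add_eq he hxy, hc] at h
  set a := inner ℂ (F e) (F (e + (x + y))) with ha
  set b := inner ℂ (F e) (F (e + x))
  have ha0 : a ≠ 0 := hF.inner_add_ne_zero he hxy
  have h1 := congrArg (fun v => inner ℂ (F e) v) h
  simp only [inner_add_right, inner_smul_right, hF.inner_chart he hx, hF.inner_chart he hy,
    hF.inner_chart he hxy, hF.inner_self_eq_one he, mul_zero, add_zero, mul_one] at h1
  refine ⟨a⁻¹ * q * c, ?_⟩
  have h2 : F e + chart F e (x + y) = a⁻¹ • (p • b • (F e + chart F e x) +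
      q • c • chart F e y) := by rw [← h, inv_smul_smul₀ ha0]
  rw [smul_smul p b, ← h1, smul_add, inv_smul_smul₀ ha0, smul_smul, smul_smul, add_assoc] at h2
  exact add_left_cancel h2

/-- Exchanging x and y gives a second decomposition of the same vector. If the coefficients were not
1, the two chart values would be proportional, and so would x and y. -/
theorem chart_add_of_ne (hF : IsOrthoMap F) (he : ‖e‖ = 1)
    {x y : H} (hx : inner ℂ e x = 0) (hy : inner ℂ e y = 0) (hx0 : x ≠ 0)
    (hxy : ∀ c : ℂ, y ≠ c • x) : chart F e (x + y) = chart F e x + chart F e y := by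
  obtain ⟨s, hs⟩ := hF.exists_chart_add_eq he hx hy
  obtain ⟨t, ht⟩ := hF.exists_chart_add_eq he hy hx
  rw [add_comm, hs] at ht
  by_cases h : s = 1
  · rw [hs, h, one_smul]
  exfalso
  have h1 : chart F e y = ((1 - t) / (1 - s)) • chart F e x := by
    have h2 : (1 - s) • chart F e y = (1 - t) • chart F e x := by
      rw [sub_smul, sub_smul, one_smul, one_smul, sub_eq_sub_iff_add_eq_add, ← ht]
    rw [div_eq_inv_mul, mul_smul, ← h2, inv_smul_smul₀ (sub_ne_zero.2 (Ne.symm h))]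
  obtain ⟨c, hc⟩ := hF.exists_map_eq_smul_chart he hy
  obtain ⟨d, hd⟩ := hF.exists_chart_eq_smul_map he hx
  rw [h1, hd, smul_smul, smul_smul] at hc
  obtain ⟨c', hc'⟩ := hF.exists_eq_smul hx0 hc
  exact hxy c' hc'

theorem chart_add (hF : IsOrthoMap F) (he : ‖e‖ = 1)
    (hH : ¬ FiniteDimensional ℂ H) {x y : H} (hx : inner ℂ e x = 0)
    (hy : inner ℂ e y = 0) : chart F e (x + y) = chart F e x + chart F e y := by
  by_cases hx0 : x = 0
  · rw [hx0, hF.chart_zero he, zero_add, zero_add]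
  by_cases hxy : ∀ c : ℂ, y ≠ c • x
  · exact hF.chart_add_of_ne he hx hy hx0 hxy
  push Not at hxy
  obtain ⟨c, rfl⟩ := hxy
  -- For dependent vectors, take z orthogonal to e and x and expand the chart at (1 + c)x + z = x +
  -- (cx + z) in two ways using only independent pairs.
  have : FiniteDimensional ℂ (Submodule.span ℂ {e, x}) :=
    FiniteDimensional.span_of_finite ℂ (Set.toFinite _)
  obtain ⟨z, hz, hz0⟩ := exists_ne_zero_mem_orthogonal hH (Submodule.span ℂ {e, x})
  rw [Submodule.mem_orthogonal] at hz
  have hez : inner ℂ e z = 0 := hz e (Submodule.subset_span (by simp))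
  have hxz : inner ℂ x z = 0 := hz x (Submodule.subset_span (by simp))
  have hd : ∀ d : ℂ, chart F e (d • x + z) = chart F e (d • x) + chart F e z := by
    intro d
    by_cases hd0 : d = 0
    · rw [hd0, zero_smul, hF.chart_zero he, zero_add, zero_add]
    refine hF.chart_add_of_ne he (by rw [inner_smul_right, hx, mul_zero]) hez
      (smul_ne_zero hd0 hx0) fun b hb => hz0 ?_
    rw [← inner_self_eq_zero (𝕜 := ℂ)]
    nth_rewrite 1 [hb]
    rw [inner_smul_left, inner_smul_left, hxz, mul_zero, mul_zero]
  have h1 : chart F e (x + (c • x + z)) = chart F e x + chart F e (c • x + z) := by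
    refine hF.chart_add_of_ne he hx (by rw [inner_add_right, hy, hez, add_zero]) hx0
      fun b hb => hz0 ?_
    have hb' : z = (b - c) • x := by rw [sub_smul, ← hb, add_sub_cancel_left]
    rw [← inner_self_eq_zero (𝕜 := ℂ)]
    nth_rewrite 1 [hb']
    rw [inner_smul_left, hxz, mul_zero]
  have h2 := hd (1 + c)
  have h3 : (1 + c) • x + z = x + (c • x + z) := by module
  rw [h3, h1, hd c, ← add_assoc, add_smul, one_smul] at h2
  exact (add_right_cancel h2).symm

/-- The value -1 says exactly that e + x and e + y are orthogonal, a relation that F preserves. -/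
theorem inner_chart_chart (hF : IsOrthoMap F) (he : ‖e‖ = 1)
    {x y : H} (hx : inner ℂ e x = 0) (hy : inner ℂ e y = 0)
    (hxy : inner ℂ x y = -1) : inner ℂ (chart F e x) (chart F e y) = -1 := by
  have hxe : inner ℂ x e = 0 := inner_eq_zero_symm.1 hx
  have h : inner ℂ (F (e + x)) (F (e + y)) = 0 := by
    rw [hF.inner_eq_zero_iff, inner_add_left, inner_add_right, inner_add_right, hxy, hy, hxe,
      inner_self_eq_norm_sq_to_K, he]
    simp
  rw [hF.map_add_eq he hx, hF.map_add_eq he hy, inner_smul_left, inner_smul_right,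
    mul_eq_zero, mul_eq_zero, map_eq_zero] at h
  have h1 := (h.resolve_left (hF.inner_add_ne_zero he hx)).resolve_left
    (hF.inner_add_ne_zero he hy)
  rw [inner_add_left, inner_add_right, inner_add_right, hF.inner_self_eq_one he,
    hF.inner_chart he hy, inner_eq_zero_symm.1 (hF.inner_chart he hx)] at h1
  linear_combination h1

theorem continuous_chart (hF : IsOrthoMap F) (he : ‖e‖ = 1)
    : Continuous fun x : (ℂ ∙ e)ᗮ => chart F e x := by
  have hK : ∀ x : (ℂ ∙ e)ᗮ, inner ℂ e (x : H) = 0 := fun x =>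
    Submodule.mem_orthogonal_singleton_iff_inner_right.1 x.2
  have h1 : Continuous fun x : (ℂ ∙ e)ᗮ => F (e + x) := by
    refine hF.continuousOn.comp_continuous (by fun_prop) fun x h0 => ?_
    refine hF.inner_add_ne_zero he (hK x) ?_
    rw [Set.mem_singleton_iff] at h0
    rw [h0, hF.map_eq_zero_iff.2 rfl, inner_zero_right]
  exact (((continuous_const.inner h1).inv₀ fun x => hF.inner_add_ne_zero he (hK x)).smul
    h1).sub continuous_const

/-- The affine chart expression is a real-linear isometry. -/
theorem exists_linearIsometry (hF : IsOrthoMap F) (he : ‖e‖ = 1) (hH : ¬ FiniteDimensional ℂ H) :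
    ∃ B : (ℂ ∙ e)ᗮ →ₗᵢ[ℝ] H, ∀ x, B x = chart F e x := by
  have hK : ∀ x : (ℂ ∙ e)ᗮ, inner ℂ e (x : H) = 0 := fun x =>
    Submodule.mem_orthogonal_singleton_iff_inner_right.1 x.2
  let B₀ : (ℂ ∙ e)ᗮ →+ H :=
    { toFun := fun x => chart F e x
      map_zero' := hF.chart_zero he
      map_add' := fun x y => hF.chart_add he hH (hK x) (hK y) }
  -- A continuous additive map is real-linear.
  let B : (ℂ ∙ e)ᗮ →L[ℝ] H := B₀.toRealLinearMap (hF.continuous_chart he)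
  refine ⟨⟨B.toLinearMap, fun x => ?_⟩, fun x => rfl⟩
  change ‖B x‖ = ‖x‖
  by_cases hx0 : x = 0
  · simp [hx0]
  have hx' : ‖x‖ ≠ 0 := norm_ne_zero_iff.2 hx0
  -- The real multiple of x with ⟨x, y⟩ = -1; as B y is the same multiple of B x, the norm of B x
  -- can be read off.
  let y : (ℂ ∙ e)ᗮ := (-(‖x‖ ^ 2)⁻¹ : ℝ) • x
  have hxy : inner ℂ (x : H) (y : H) = -1 := by
    change inner ℂ (x : H) ((-(‖x‖ ^ 2)⁻¹ : ℝ) • (x : H)) = -1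
    rw [← Complex.coe_smul, inner_smul_right, inner_self_eq_norm_sq_to_K]
    have : (‖(x : H)‖ : ℂ) ≠ 0 := by exact_mod_cast hx'
    push_cast
    field_simp
    simp [hx0]
  have h1 : inner ℂ (B x) (B y) = -1 := hF.inner_chart_chart he (hK x) (hK y) hxy
  rw [_root_.map_smul, ← Complex.coe_smul, inner_smul_right, inner_self_eq_norm_sq_to_K] at h1
  have h2 : -(‖x‖ ^ 2)⁻¹ * ‖B x‖ ^ 2 = -1 := by
    refine Complex.ofReal_injective ?_
    push_cast at h1 ⊢
    exact h1
  field_simp at h2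
  have h3 : ‖B x‖ ^ 2 = ‖x‖ ^ 2 := by linarith
  exact (sq_eq_sq₀ (norm_nonneg _) (norm_nonneg _)).1 h3

/-- F preserves complex lines, so B (ix) = τ B x. The isometry property gives |τ| = 1 and |1 + τ| =
|1 + i|, hence τ = ±i. -/
theorem linearIsometry_smul_I (hF : IsOrthoMap F) (he : ‖e‖ = 1)
    (B : (ℂ ∙ e)ᗮ →ₗᵢ[ℝ] H) (hB : ∀ x, B x = chart F e x) :
    (∀ x, B (Complex.I • x) = Complex.I • B x) ∨ ∀ x, B (Complex.I • x) = -(Complex.I • B x) := by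
  have hK : ∀ x : (ℂ ∙ e)ᗮ, inner ℂ e (x : H) = 0 := fun x =>
    Submodule.mem_orthogonal_singleton_iff_inner_right.1 x.2
  have key : ∀ x, B (Complex.I • x) = Complex.I • B x ∨ B (Complex.I • x) = -(Complex.I • B x) := by
    intro x
    by_cases hx0 : x = 0
    · left
      simp [hx0]
    have hx' : ‖x‖ ≠ 0 := norm_ne_zero_iff.2 hx0
    obtain ⟨c, hc⟩ := hF.exists_chart_eq_smul_map he (hK (Complex.I • x))
    obtain ⟨d, hd⟩ := hF.exists_map_eq_smul_chart he (hK x)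
    have h1 : B (Complex.I • x) = (c * Complex.I * d) • B x := by
      rw [hB, hB, hc, Submodule.coe_smul, hF.map_smul, hd, smul_smul, smul_smul, mul_assoc]
    set τ := c * Complex.I * d
    have h2 : ‖τ‖ = 1 := by
      have := congrArg norm h1
      rw [B.norm_map, norm_smul, norm_smul, B.norm_map, Complex.norm_I] at this
      exact (mul_right_cancel₀ hx' this).symm
    have h3 : ‖1 + τ‖ = ‖1 + Complex.I‖ := by
      have h4 : B ((1 + Complex.I) • x) = (1 + τ) • B x := by
        rw [add_smul, add_smul, one_smul, one_smul, map_add, h1]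
      have := congrArg norm h4
      rw [B.norm_map, norm_smul, norm_smul, B.norm_map] at this
      exact (mul_right_cancel₀ hx' this).symm
    have h5 : τ.re * τ.re + τ.im * τ.im = 1 := by
      rw [← Complex.normSq_apply, Complex.normSq_eq_norm_sq, h2, one_pow]
    have h6 : (1 + τ.re) * (1 + τ.re) + τ.im * τ.im = 2 := by
      have := congrArg (· ^ 2) h3
      simp only [← Complex.normSq_eq_norm_sq, Complex.normSq_apply] at this
      norm_num at this
      linarith
    have h7 : τ.re = 0 := by nlinarith
    have h8 : (τ.im - 1) * (τ.im + 1) = 0 := by rw [h7] at h5; linarith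
    rw [h1]
    rcases mul_eq_zero.1 h8 with h | h
    · left
      congr 1
      apply Complex.ext <;> simp [h7]
      linarith
    · right
      rw [← neg_smul]
      congr 1
      apply Complex.ext <;> simp [h7]
      linarith
  -- The sign does not depend on x: each sign holds on an additive subgroup, and a group is not the
  -- union of two proper subgroups.
  by_contra! hcon
  obtain ⟨⟨x, hx⟩, y, hy⟩ := hcon
  have hx' := (key x).resolve_left hx
  have hy' := (key y).resolve_right hy
  rcases key (x + y) with h | h
  · rw [smul_add, map_add, map_add, hy', smul_add, add_left_inj] at h
    exact hx h
  · rw [smul_add, map_add, map_add, hx', smul_add, neg_add, add_right_inj] at h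
    exact hy h

/-- V extends B by sending e to F e. Off the complement of e, homogeneity reduces the comparison
with F to the chart; the norms force the factor to be a phase. The σ is the identity or the
conjugation in the applications. -/
theorem exists_linearIsometryEquiv (hF : IsOrthoMap F) (he : ‖e‖ = 1)
    (σ : ℂ →+* ℂ) [RingHomInvPair σ σ] (hσ : ∀ c, ‖σ c‖ = ‖c‖)
    (B : (ℂ ∙ e)ᗮ →ₗᵢ[ℝ] H) (hB : ∀ x, B x = chart F e x)
    (hBσ : ∀ (c : ℂ) x, B (c • x) = σ c • B x) :
    ∃ V : H ≃ₛₗᵢ[σ] H, ∀ v, ∃ c : ℂ, ‖c‖ = 1 ∧ F v = c • V v := by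
  have hK : ∀ x : (ℂ ∙ e)ᗮ, inner ℂ e (x : H) = 0 := fun x =>
    Submodule.mem_orthogonal_singleton_iff_inner_right.1 x.2
  let P := (ℂ ∙ e)ᗮ.orthogonalProjectionOnto
  let V₀ : H →ₛₗ[σ] H :=
    { toFun := fun v => σ (inner ℂ e v) • F e + B (P v)
      map_add' := fun v w => by
        rw [inner_add_right, map_add, map_add, map_add, add_smul]
        abel
      map_smul' := fun c v => by
        rw [inner_smul_right, map_mul, _root_.map_smul, hBσ, mul_smul, smul_add] }
  have hV₀ : ∀ v, V₀ v = σ (inner ℂ e v) • F e + B (P v) := fun v => rfl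
  have hdec : ∀ v : H, v = inner ℂ e v • e + (P v : H) := fun v => by
    have h1 := (ℂ ∙ e).starProjection_add_starProjection_orthogonal v
    rw [Submodule.starProjection_unit_singleton ℂ he] at h1
    exact h1.symm
  have hnorm : ∀ v, ‖V₀ v‖ = ‖v‖ := fun v => by
    have h1 : inner ℂ (σ (inner ℂ e v) • F e) (B (P v)) = 0 := by
      rw [inner_smul_left, hB, hF.inner_chart he (hK _), mul_zero]
    have h2 : inner ℂ (inner ℂ e v • e) (P v : H) = 0 := by
      rw [inner_smul_left, hK, mul_zero]
    have h3 := norm_add_sq_eq_norm_sq_add_norm_sq_of_inner_eq_zero _ _ h1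
    have h4 := norm_add_sq_eq_norm_sq_add_norm_sq_of_inner_eq_zero _ _ h2
    rw [← hdec, norm_smul] at h4
    rw [← hV₀, norm_smul, hσ, hF.norm_map, B.norm_map, Submodule.coe_norm, ← h4] at h3
    exact (mul_self_inj (norm_nonneg _) (norm_nonneg _)).1 h3
  have hprop : ∀ v, ∃ c : ℂ, F v = c • V₀ v := fun v => by
    by_cases hv : inner ℂ e v = 0
    · obtain ⟨c, hc⟩ := hF.exists_map_eq_smul_chart he hv
      have hPv : (P v : H) = v := by
        have := hdec v
        rw [hv, zero_smul, zero_add] at this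
        exact this.symm
      refine ⟨c, ?_⟩
      rw [hc, hV₀, hv, map_zero, zero_smul, zero_add, hB, hPv]
    · set a := inner ℂ e v with ha
      have h1 : v = a • (e + ((a⁻¹ • P v : (ℂ ∙ e)ᗮ) : H)) := by
        rw [smul_add, Submodule.coe_smul, smul_inv_smul₀ hv]
        exact hdec v
      have h2 : V₀ v = σ a • (F e + chart F e ((a⁻¹ • P v : (ℂ ∙ e)ᗮ) : H)) := by
        rw [hV₀, ← hB, smul_add, ← hBσ, smul_inv_smul₀ hv]
      have hσa : σ a ≠ 0 := (map_ne_zero σ).2 hv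
      refine ⟨a * inner ℂ (F e) (F (e + ((a⁻¹ • P v : (ℂ ∙ e)ᗮ) : H))) * (σ a)⁻¹, ?_⟩
      rw [h2, smul_smul, inv_mul_cancel_right₀ hσa, mul_smul, ← hF.map_add_eq he (hK _),
        ← hF.map_smul, ← h1]
  have hprop' : ∀ v, ∃ c : ℂ, ‖c‖ = 1 ∧ F v = c • V₀ v := fun v => by
    by_cases hv : v = 0
    · exact ⟨1, norm_one, by rw [hv, hF.map_eq_zero_iff.2 rfl, map_zero, smul_zero]⟩
    obtain ⟨c, hc⟩ := hprop v
    refine ⟨c, ?_, hc⟩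
    have := congrArg norm hc
    rw [hF.norm_map, norm_smul, hnorm] at this
    exact (mul_eq_right₀ (norm_ne_zero_iff.2 hv)).1 this.symm
  let V₁ : H →ₛₗᵢ[σ] H := ⟨V₀, hnorm⟩
  have hsurj : Function.Surjective V₁ := fun w => by
    obtain ⟨v, rfl⟩ := hF.surjective w
    obtain ⟨c, hc⟩ := hprop v
    -- σ is its own inverse, so the factor c is absorbed as σ c inside the σ-linear map.
    refine ⟨σ c • v, ?_⟩
    rw [hc]
    change V₀ (σ c • v) = c • V₀ v
    rw [LinearMap.map_smulₛₗ, RingHomInvPair.comp_apply_eq]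
  exact ⟨LinearIsometryEquiv.ofSurjective V₁ hsurj, hprop'⟩

end IsOrthoMap

/-- **Uhlhorn's theorem** for homogeneous continuous maps. -/
theorem IsOrthoMap.unitary_or_antiunitary (hH : ¬ FiniteDimensional ℂ H) {F : H → H}
    (hF : IsOrthoMap F) :
    (∃ V : H ≃ₗᵢ[ℂ] H, ∀ v, ∃ c : ℂ, ‖c‖ = 1 ∧ F v = c • V v) ∨
    ∃ V : H ≃ₛₗᵢ[starRingEnd ℂ] H, ∀ v, ∃ c : ℂ, ‖c‖ = 1 ∧ F v = c • V v := by
  obtain ⟨z, -, hz⟩ := exists_ne_zero_mem_orthogonal hH ⊥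
  obtain ⟨e, he⟩ : ∃ e : H, ‖e‖ = 1 := by
    refine ⟨((‖z‖⁻¹ : ℝ) : ℂ) • z, ?_⟩
    rw [norm_smul, Complex.norm_real, norm_inv, norm_norm, inv_mul_cancel₀ (norm_ne_zero_iff.2 hz)]
  obtain ⟨B, hB⟩ := hF.exists_linearIsometry he hH
  have hlin : ∀ (c : ℂ) x, B (c • x) = c.re • B x + c.im • B (Complex.I • x) := fun c x => by
    rw [← B.map_smul, ← B.map_smul, ← B.map_add]
    congr 1
    nth_rewrite 1 [← Complex.re_add_im c]
    rw [add_smul, mul_smul, Complex.coe_smul, Complex.coe_smul]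
  rcases hF.linearIsometry_smul_I he B hB with h | h
  · refine Or.inl
      (hF.exists_linearIsometryEquiv he (RingHom.id ℂ) (fun _ => rfl) B hB fun c x => ?_)
    rw [hlin, h, RingHom.id_apply]
    nth_rewrite 3 [← Complex.re_add_im c]
    simp only [add_smul, mul_smul, Complex.coe_smul]
  · refine Or.inr (hF.exists_linearIsometryEquiv he (starRingEnd ℂ) (by simp) B hB fun c x => ?_)
    rw [hlin, h]
    nth_rewrite 3 [← Complex.re_add_im c]
    rw [map_add, map_mul, Complex.conj_ofReal, Complex.conj_ofReal, Complex.conj_I]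
    simp only [add_smul, mul_smul, Complex.coe_smul, neg_smul]

end Uhlhorn

/-! ### Continuous logarithms of circle-valued functions -/

section Lifting

variable {E : Type*} [NormedAddCommGroup E] [NormedSpace ℝ E]

-- A star-convex open set is contractible and locally path connected, so maps from it lift through
-- the covering `Circle.exp`. The value 0 off the set plays no role.
open Classical in
theorem exists_lift_of_starConvex {s : Set E} {p : E} (hs : StarConvex ℝ p s) (ho : IsOpen s)
    (hp : p ∈ s) {c : E → Circle} (hc : ContinuousOn c s) :
    ∃ h : E → ℝ, ContinuousOn h s ∧ ∀ x ∈ s, Circle.exp (h x) = c x := by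
  have := hs.contractibleSpace ⟨p, hp⟩
  have := ho.locallyPathConnectedSpace
  obtain ⟨t, ht⟩ := Circle.exp_surjective (c p)
  obtain ⟨f, ⟨-, hf⟩, -⟩ := Circle.isCoveringMap_exp.existsUnique_continuousMap_lifts
    ⟨s.domRestrict c, continuousOn_iff_continuous_domRestrict.1 hc⟩ ⟨p, hp⟩ t ht
  refine ⟨fun x => if hx : x ∈ s then f ⟨x, hx⟩ else 0, ?_, fun x hx => ?_⟩
  · rw [continuousOn_iff_continuous_domRestrict]
    convert! map_continuous f
    ext x
    exact dif_pos x.2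
  · simp only [dif_pos hx]
    exact congrFun hf ⟨x, hx⟩

/-- The complement of the closed half-line opposite to `p`; here `r` is a form with `r p = 1`. -/
def slit (r : E →L[ℝ] ℝ) (p : E) : Set E := {v | v = r v • p → 0 < r v}

theorem isOpen_slit (r : E →L[ℝ] ℝ) (p : E) : IsOpen (slit r p) := by
  have : slit r p = {v | v ≠ r v • p} ∪ {v | 0 < r v} := by
    ext v
    simp only [slit, Set.mem_ofPred_eq, Set.mem_union]
    tauto
  rw [this]
  exact (isOpen_ne_fun continuous_id (by fun_prop)).union (isOpen_lt continuous_const r.continuous)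

/-- If ap + bx with b ≠ 0 lies on the line of p, so does x; then r x > 0 and r stays positive on the
segment. -/
theorem starConvex_slit {r : E →L[ℝ] ℝ} {p : E} (hp : r p = 1) : StarConvex ℝ p (slit r p) := by
  intro x hx a b ha hb hab h
  simp only [map_add, map_smul, hp, smul_eq_mul, mul_one] at h ⊢
  by_cases hb0 : b = 0
  · subst hb0
    linarith
  have h1 : b • x = b • (r x • p) := by
    rw [add_smul, mul_smul] at h
    exact add_left_cancel h
  have h2 : 0 < r x := hx (smul_right_injective E hb0 h1)
  have : 0 < b := lt_of_le_of_ne hb (Ne.symm hb0)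
  positivity

theorem eqOn_of_circleExp_eq {X : Type*} [TopologicalSpace X] {s : Set X} (hs : IsPreconnected s)
    {f g : X → ℝ} (hf : ContinuousOn f s) (hg : ContinuousOn g s)
    (h : ∀ x ∈ s, Circle.exp (f x) = Circle.exp (g x)) {a : X} (ha : a ∈ s) (hfg : f a = g a) :
    s.EqOn f g :=
  Circle.isCoveringMap_exp.eqOn_of_comp_eqOn hs hf hg h ha hfg

open Classical in
/-- Continuous circle-valued functions on a punctured space have a continuous logarithm. -/
theorem exists_lift_of_punctured {r : E →L[ℝ] ℝ} {p : E} (hp : r p = 1)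
    (hcodim : 1 < Module.rank ℝ (E ⧸ (ℝ ∙ p))) {c : E → Circle} (hc : ContinuousOn c {0}ᶜ) :
    ∃ h : E → ℝ, ContinuousOn h {0}ᶜ ∧ ∀ x ≠ 0, Circle.exp (h x) = c x := by
  have hp' : (-r) (-p) = 1 := by simp [hp]
  -- The two opposite slit domains cover the punctured space. They meet in the complement of the
  -- line of p, which is connected by the codimension hypothesis, so lifts on them can be glued.
  set A := slit r p with hA
  set B := slit (-r) (-p) with hB
  have hBmem : ∀ v, v ∈ B ↔ (v = r v • p → r v < 0) := fun v => by
    simp [hB, slit]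
  have hA0 : A ⊆ {0}ᶜ := by
    rintro v hv rfl
    simp [hA, slit] at hv
  have hB0 : B ⊆ {0}ᶜ := by
    rintro v hv rfl
    simp [hB, slit] at hv
  have hAo : IsOpen A := isOpen_slit r p
  have hBo : IsOpen B := isOpen_slit _ _
  have hcov : ∀ v : E, v ≠ 0 → v ∉ A → v ∈ B := by
    intro v hv hvA
    rw [hBmem]
    intro h
    have h1 : ¬ 0 < r v := fun h2 => hvA fun _ => h2
    refine lt_of_le_of_ne (not_lt.1 h1) fun h2 => hv ?_
    rw [h, h2, zero_smul]
  have hinter : A ∩ B = ((ℝ ∙ p : Submodule ℝ E) : Set E)ᶜ := by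
    ext v
    rw [Set.mem_inter_iff, hBmem, Set.mem_compl_iff, SetLike.mem_coe,
      Submodule.mem_span_singleton]
    constructor
    · rintro ⟨h1, h2⟩ ⟨t, rfl⟩
      have h3 : t • p = r (t • p) • p := by simp [hp]
      exact lt_asymm (h1 h3) (h2 h3)
    · intro h
      have h1 : v ≠ r v • p := fun h1 => h ⟨r v, h1.symm⟩
      exact ⟨fun h2 => absurd h2 h1, fun h2 => absurd h2 h1⟩
  have hconn : IsConnected (A ∩ B) := by
    rw [hinter]
    exact isConnected_compl_of_one_lt_codim hcodim
  obtain ⟨f, hf, hfc⟩ := exists_lift_of_starConvex (starConvex_slit hp) hAo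
    (fun _ => by rw [hp]; exact one_pos) (hc.mono hA0)
  obtain ⟨g, hg, hgc⟩ := exists_lift_of_starConvex (starConvex_slit hp') hBo
    (fun _ => by rw [hp']; exact one_pos) (hc.mono hB0)
  obtain ⟨a, ha⟩ := hconn.nonempty
  -- The shift is a difference of two logarithms of c a, so g' is still a logarithm of c; it agrees
  -- with f at a, hence on the whole intersection.
  let g' : E → ℝ := fun x => g x + (f a - g a)
  have hg' : ContinuousOn g' B := hg.add continuousOn_const
  have hgc' : ∀ x ∈ B, Circle.exp (g' x) = c x := fun x hx => by
    rw [Circle.exp_add, Circle.exp_sub, hgc x hx, hfc a ha.1, hgc a ha.2, div_self', mul_one]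
  have heq : (A ∩ B).EqOn f g' :=
    eqOn_of_circleExp_eq hconn.isPreconnected (hf.mono Set.inter_subset_left)
      (hg'.mono Set.inter_subset_right) (fun x hx => by rw [hfc x hx.1, hgc' x hx.2]) ha
      (by simp [g'])
  let h : E → ℝ := fun x => if x ∈ A then f x else g' x
  have hhA : A.EqOn h f := fun x hx => if_pos hx
  have hhB : B.EqOn h g' := fun x hx => by
    by_cases hxA : x ∈ A
    · rw [hhA hxA, heq ⟨hxA, hx⟩]
    · exact if_neg hxA
  refine ⟨h, fun x hx => ?_, fun x hx => ?_⟩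
  · by_cases hxA : x ∈ A
    · exact (((hf.congr hhA).continuousAt (hAo.mem_nhds hxA))).continuousWithinAt
    · exact (((hg'.congr hhB).continuousAt
        (hBo.mem_nhds (hcov x hx hxA)))).continuousWithinAt
  · by_cases hxA : x ∈ A
    · rw [hhA hxA, hfc x hxA]
    · rw [hhB (hcov x hx hxA), hgc' x (hcov x hx hxA)]

theorem one_lt_rank_quotient (hH : ¬ FiniteDimensional ℂ H) (p : H) :
    1 < Module.rank ℝ (H ⧸ (ℝ ∙ p)) := by
  by_contra! h
  have h1 : Module.Finite ℝ (H ⧸ (ℝ ∙ p)) :=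
    Module.rank_lt_aleph0_iff.1 (h.trans_lt Cardinal.one_lt_aleph0)
  have h2 : Module.Finite ℝ H := Module.Finite.of_submodule_quotient (ℝ ∙ p)
  exact hH (Module.Finite.of_restrictScalars_finite ℝ ℂ _)

-- Extend c radially to the punctured space and restrict the logarithm found there; the value of the
-- extension at 0 is arbitrary.
open Classical in
theorem exists_state_lift (hH : ¬ FiniteDimensional ℂ H) {c : State H → Circle}
    (hc : Continuous c) :
    ∃ h : State H → ℝ, Continuous h ∧ ∀ φ, Circle.exp (h φ) = c φ := by
  obtain ⟨z, -, hz⟩ := exists_ne_zero_mem_orthogonal hH ⊥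
  obtain ⟨r, hr⟩ := SeparatingDual.exists_eq_one (R := ℝ) hz
  let C : H → Circle := fun v => if hv : v ≠ 0 then c (normalize v hv) else 1
  have hC : ContinuousOn C {0}ᶜ := by
    rw [continuousOn_iff_continuous_domRestrict]
    have h1 : ({0}ᶜ : Set H).domRestrict C = fun v : ({0}ᶜ : Set H) =>
        c (normalize v v.2) := funext fun v => dif_pos v.2
    rw [h1]
    exact hc.comp (Continuous.subtype_mk (continuousOn_iff_continuous_domRestrict.1
      (contDiffOn_radial (H := H) 0).continuousOn) _)
  obtain ⟨h, hh, hhC⟩ := exists_lift_of_punctured hr (one_lt_rank_quotient hH z) hC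
  refine ⟨fun φ => h φ, hh.comp_continuous continuous_subtype_val fun φ => φ.coe_ne_zero,
    fun φ => ?_⟩
  rw [hhC _ φ.coe_ne_zero]
  simp only [C, dif_pos φ.coe_ne_zero, normalize_coe]

end Lifting

/-! ### Unitary square roots -/

section SquareRoot

/-- For self-adjoint `S` and any `T` with `S T = 0` there is a symmetry `J` with `J (S + T) = S - T`
that commutes with all self-adjoint operators commuting with `S`. -/
theorem exists_symmetry [CompleteSpace H] {S T : H →L[ℂ] H} (hS : IsSelfAdjoint S)
    (hST : S * T = 0) :
    ∃ J : H →L[ℂ] H, IsSelfAdjoint J ∧ J * J = 1 ∧ J * (S + T) = S - T ∧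
      ∀ A : H →L[ℂ] H, IsSelfAdjoint A → A * S = S * A → A * J = J * A := by
  -- J is the reflection that is -1 on the kernel of S, which contains the range of T, and +1 on its
  -- orthogonal complement, which contains the range of S.
  let K : Submodule ℂ H := S.ker
  have hK : IsClosed (K : Set H) := S.isClosed_ker
  have : CompleteSpace K := hK.completeSpace_coe
  let P := K.starProjection
  have hPs : IsSelfAdjoint P := isSelfAdjoint_starProjection K
  have hPi : P * P = P := K.isIdempotentElem_starProjection
  have hP : ∀ B : H →L[ℂ] H, S * B = 0 → P * B = B := fun B hB => by
    ext x
    exact Submodule.starProjection_eq_self_iff.2 (DFunLike.congr_fun hB x)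
  have hSP : S * P = 0 := by
    ext x
    exact (K.starProjection_apply_mem x : S (P x) = 0)
  have hPS : P * S = 0 := by
    have := congrArg star hSP
    rwa [star_mul, hS.star_eq, hPs.star_eq, star_zero] at this
  have hPT : P * T = T := hP T hST
  refine ⟨1 - 2 • P, ?_, ?_, ?_, fun A hA hAS => ?_⟩
  · exact (IsSelfAdjoint.one _).sub ((IsSelfAdjoint.all (2 : ℕ)).smul hPs)
  · have : (1 - 2 • P) * (1 - 2 • P) = 1 - 4 • P + 4 • (P * P) := by noncomm_ring
    rw [this, hPi, sub_add_cancel]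
  · have : (1 - 2 • P) * (S + T) = S + T - 2 • (P * S) - 2 • (P * T) := by noncomm_ring
    rw [this, hPS, hPT]
    noncomm_ring
  · have h1 : P * (A * P) = A * P := hP _ (by rw [← mul_assoc, ← hAS, mul_assoc, hSP, mul_zero])
    have h2 := congrArg star h1
    rw [star_mul, star_mul, hA.star_eq, hPs.star_eq] at h2
    have h3 : A * P = P * A := by rw [← h1, ← mul_assoc, h2]
    rw [mul_sub, sub_mul, mul_one, one_mul, mul_smul_comm, smul_mul_assoc, h3]

theorem isSelfAdjoint_cfc_ofReal [CompleteSpace H] (V : H →L[ℂ] H) (f : ℂ → ℝ) :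
    IsSelfAdjoint (cfc (fun z => (f z : ℂ)) V) := by
  rw [IsSelfAdjoint, ← cfc_star]
  congr 1
  ext z
  simp

/-- Unitary operators have unitary square roots. -/
theorem exists_unitary_sq_eq [CompleteSpace H] {V : H →L[ℂ] H} (hV : V ∈ unitary (H →L[ℂ] H)) :
    ∃ W ∈ unitary (H →L[ℂ] H), W * W = V := by
  have hn : IsStarNormal V := ⟨by
    rw [Commute, SemiconjBy, Unitary.star_mul_self_of_mem hV, Unitary.mul_star_self_of_mem hV]⟩
  have hsp : ∀ z ∈ spectrum ℂ V, z.re * z.re + z.im * z.im = 1 := fun z hz => by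
    have := spectrum.subset_circle_of_unitary (𝕜 := ℂ) hV hz
    rw [mem_sphere_zero_iff_norm] at this
    rw [← Complex.normSq_apply, Complex.normSq_eq_norm_sq, this, one_pow]
  -- Half-angle formulas: at z = e^{iα} these are |cos(α/2)| and |sin(α/2)|, while s and t are the
  -- positive and negative parts of Im z. The root a + i·sgn(Im z)·b jumps at z = -1, so the sign is
  -- supplied by the symmetry J instead of the continuous functional calculus.
  let a : ℂ → ℝ := fun z => Real.sqrt ((1 + z.re) / 2)
  let b : ℂ → ℝ := fun z => Real.sqrt ((1 - z.re) / 2)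
  let s : ℂ → ℝ := fun z => max z.im 0
  let t : ℂ → ℝ := fun z => max (-z.im) 0
  have hac : Continuous fun z => (a z : ℂ) := by fun_prop
  have hbc : Continuous fun z => (b z : ℂ) := by fun_prop
  have hsc : Continuous fun z => (s z : ℂ) := by fun_prop
  have htc : Continuous fun z => (t z : ℂ) := by fun_prop
  have haac : Continuous fun z => (a z : ℂ) * a z := hac.mul hac
  have hbbc : Continuous fun z => (b z : ℂ) * b z := hbc.mul hbc
  have habc : Continuous fun z => (a z : ℂ) * b z := hac.mul hbc
  have haabbc : Continuous fun z => (a z : ℂ) * a z - b z * b z := haac.sub hbbc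
  have hstc : Continuous fun z => (s z : ℂ) - t z := hsc.sub htc
  have hIstc : Continuous fun z => Complex.I • ((s z : ℂ) - t z) := hstc.const_smul Complex.I
  set A := cfc (fun z => (a z : ℂ)) V with hA
  set B := cfc (fun z => (b z : ℂ)) V with hB
  set S := cfc (fun z => (s z : ℂ)) V with hS
  set T := cfc (fun z => (t z : ℂ)) V with hT
  have hAs : IsSelfAdjoint A := isSelfAdjoint_cfc_ofReal V a
  have hBs : IsSelfAdjoint B := isSelfAdjoint_cfc_ofReal V b
  have hSs : IsSelfAdjoint S := isSelfAdjoint_cfc_ofReal V s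
  have hcomm : ∀ f g : ℂ → ℂ, Commute (cfc f V) (cfc g V) := fun f g => cfc_commute_cfc f g V
  have ha2 : ∀ z ∈ spectrum ℂ V, a z * a z = (1 + z.re) / 2 := fun z hz =>
    Real.mul_self_sqrt (by nlinarith [hsp z hz])
  have hb2 : ∀ z ∈ spectrum ℂ V, b z * b z = (1 - z.re) / 2 := fun z hz =>
    Real.mul_self_sqrt (by nlinarith [hsp z hz])
  have hab : ∀ z ∈ spectrum ℂ V, 2 * (a z * b z) = s z + t z := fun z hz => by
    have h1 : a z * b z = |z.im| / 2 := by
      rw [← Real.sqrt_mul (by nlinarith [hsp z hz]),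
        ← Real.sqrt_sq (by positivity : 0 ≤ |z.im| / 2)]
      congr 1
      rw [div_pow, sq_abs]
      linarith [hsp z hz]
    rw [h1]
    rcases le_total 0 z.im with h | h
    · simp only [s, t, abs_of_nonneg h, max_eq_left h, max_eq_right (neg_nonpos.2 h)]
      ring
    · simp only [s, t, abs_of_nonpos h, max_eq_right h, max_eq_left (neg_nonneg.2 h)]
      ring
  have hst : ∀ z, s z * t z = 0 := fun z => by
    rcases le_total 0 z.im with h | h
    · simp [s, t, h]
    · simp [s, t, h]
  have hst' : ∀ z, s z - t z = z.im := fun z => by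
    rcases le_total 0 z.im with h | h
    · simp [s, t, h]
    · simp [s, t, h]
  have hST : S * T = 0 := by
    rw [hS, hT, ← cfc_mul _ _ V hsc.continuousOn htc.continuousOn, ← cfc_zero ℂ V]
    refine cfc_congr fun z _ => ?_
    change (s z : ℂ) * t z = 0
    exact_mod_cast hst z
  have hAB : A * A + B * B = 1 := by
    rw [hA, hB, ← cfc_mul _ _ V hac.continuousOn hac.continuousOn,
      ← cfc_mul _ _ V hbc.continuousOn hbc.continuousOn,
      ← cfc_add V _ _ haac.continuousOn hbbc.continuousOn, ← cfc_one ℂ V]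
    refine cfc_congr fun z hz => ?_
    have : a z * a z + b z * b z = 1 := by
      rw [ha2 z hz, hb2 z hz]
      ring
    change (a z : ℂ) * a z + b z * b z = 1
    exact_mod_cast this
  have hABST : A * B + A * B = S + T := by
    rw [hA, hB, hS, hT, ← cfc_mul _ _ V hac.continuousOn hbc.continuousOn,
      ← cfc_add V _ _ habc.continuousOn habc.continuousOn,
      ← cfc_add V _ _ hsc.continuousOn htc.continuousOn]
    refine cfc_congr fun z hz => ?_
    have : a z * b z + a z * b z = s z + t z := by rw [← hab z hz, two_mul]
    exact_mod_cast this
  have hVeq : A * A - B * B + Complex.I • (S - T) = V := by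
    rw [hA, hB, hS, hT, ← cfc_mul _ _ V hac.continuousOn hac.continuousOn,
      ← cfc_mul _ _ V hbc.continuousOn hbc.continuousOn,
      ← cfc_sub _ _ V haac.continuousOn hbbc.continuousOn,
      ← cfc_sub _ _ V hsc.continuousOn htc.continuousOn,
      ← cfc_smul Complex.I _ V hstc.continuousOn,
      ← cfc_add V _ _ haabbc.continuousOn hIstc.continuousOn]
    refine Eq.trans ?_ (cfc_id ℂ V)
    refine cfc_congr fun z hz => ?_
    have h1 : a z * a z - b z * b z = z.re := by
      rw [ha2 z hz, hb2 z hz]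
      ring
    have h2 := hst' z
    change (a z : ℂ) * a z - b z * b z + Complex.I * (s z - t z) = z
    rw [← Complex.ofReal_mul, ← Complex.ofReal_mul, ← Complex.ofReal_sub, ← Complex.ofReal_sub, h1,
      h2, mul_comm, Complex.re_add_im]
  obtain ⟨J, hJs, hJJ, hJST, hJ⟩ := exists_symmetry hSs hST
  have hAJ : A * J = J * A := hJ A hAs (hcomm _ _)
  have hBJ : B * J = J * B := hJ B hBs (hcomm _ _)
  have hBA : B * A = A * B := hcomm _ _
  have hAJB : A * (J * B) = J * (A * B) := by rw [← mul_assoc, hAJ, mul_assoc]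
  have hJBA : J * B * A = J * (A * B) := by rw [mul_assoc, hBA]
  have hJBJB : J * B * (J * B) = B * B := by
    rw [← mul_assoc, mul_assoc J B J, hBJ, ← mul_assoc J J B, hJJ, one_mul]
  have hWs : star (A + Complex.I • (J * B)) = A - Complex.I • (J * B) := by
    rw [star_add, star_smul, star_mul, hAs.star_eq, hBs.star_eq, hJs.star_eq, hBJ,
      RCLike.star_def, Complex.conj_I, neg_smul, sub_eq_add_neg]
  -- As J commutes with A and B, the square is A² - B² + 2iJAB. Since 2AB = S + T and J(S + T) = S -
  -- T, this is V.
  refine ⟨A + Complex.I • (J * B), Unitary.mem_iff.2 ⟨?_, ?_⟩, ?_⟩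
  · rw [hWs, sub_mul, mul_add, mul_add, mul_smul_comm, smul_mul_assoc, smul_mul_smul_comm, hAJB,
      hJBA, hJBJB, Complex.I_mul_I, neg_one_smul, ← hAB]
    abel
  · rw [hWs, add_mul, mul_sub, mul_sub, mul_smul_comm, smul_mul_assoc, smul_mul_smul_comm, hAJB,
      hJBA, hJBJB, Complex.I_mul_I, neg_one_smul, ← hAB]
    abel
  · rw [add_mul, mul_add, mul_add, mul_smul_comm, smul_mul_assoc, smul_mul_smul_comm, hAJB,
      hJBA, hJBJB, Complex.I_mul_I, neg_one_smul]
    rw [← hJST, ← hABST, mul_add, smul_add] at hVeq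
    rw [← hVeq]
    abel

theorem exists_linearIsometryEquiv_sq_eq [CompleteSpace H] (V : H ≃ₗᵢ[ℂ] H) :
    ∃ W : H ≃ₗᵢ[ℂ] H, ∀ v, W (W v) = V v := by
  let u := Unitary.linearIsometryEquiv.symm V
  obtain ⟨W, hW, hWV⟩ := exists_unitary_sq_eq u.2
  exact ⟨Unitary.linearIsometryEquiv ⟨W, hW⟩, fun v => DFunLike.congr_fun hWV v⟩

end SquareRoot

/-! ### From rays to maps: the phase factor and the exclusion of antiunitaries -/

section Wigner

variable {k : ℕ∞}

theorem IsSemiAutomorphism.isOrthoMap [CompleteSpace H] (hH : ¬ FiniteDimensional ℂ H)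
    (hk : 1 ≤ k) {Φ : Equiv.Perm (State H)} (hΦ : IsSemiAutomorphism k Φ) :
    IsOrthoMap (homExt Φ) := by
  obtain ⟨hd, hc, ho⟩ := isSemiAutomorphism_iff.1 hΦ
  refine ⟨(contDiffOn_homExt hd.1).continuousOn, homExt_smul hc, norm_homExt,
    fun v w => ⟨fun h => ?_, inner_homExt_eq_zero ho⟩, fun v => ⟨homExt Φ.symm v, ?_⟩⟩
  · by_cases hv : v = 0
    · rw [hv, inner_zero_left]
    · exact inner_eq_zero_of_homExt hH hk hd ho hv h
  · rw [homExt_comp, Equiv.self_comp_symm, homExt_id]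

theorem IsSemiAutomorphism.isUnitaryType_or_isAntiunitaryType [CompleteSpace H]
    (hH : ¬ FiniteDimensional ℂ H) (hk : 1 ≤ k) {Φ : Equiv.Perm (State H)}
    (hΦ : IsSemiAutomorphism k Φ) : IsUnitaryType Φ ∨ IsAntiunitaryType Φ := by
  refine ((hΦ.isOrthoMap hH hk).unitary_or_antiunitary hH).imp ?_ ?_
  all_goals
    rintro ⟨V, hV⟩
    refine ⟨V, fun φ => ?_⟩
    obtain ⟨c, hc, h⟩ := hV φ
    exact ⟨c, hc, by rw [← h, homExt_coe]⟩

/-- A phase factor between two continuous maps into the sphere has a continuous logarithm. -/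
theorem exists_continuous_phase (hH : ¬ FiniteDimensional ℂ H) {f g : State H → H}
    (hf : Continuous f) (hg : Continuous g) (hfn : ∀ φ, ‖f φ‖ = Real.sqrt 2)
    (hfg : ∀ φ, ∃ c : ℂ, ‖c‖ = 1 ∧ g φ = c • f φ) :
    ∃ h : State H → ℝ, Continuous h ∧
      (∀ φ, Complex.exp (h φ * Complex.I) = inner ℂ (f φ) (g φ) / 2) ∧
      ∀ φ, g φ = Complex.exp (h φ * Complex.I) • f φ := by
  -- Because ‖f φ‖² = 2, half the inner product recovers the phase, and it is continuous in φ.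
  have key : ∀ φ, ‖inner ℂ (f φ) (g φ) / 2‖ = 1 ∧ g φ = (inner ℂ (f φ) (g φ) / 2) • f φ := by
    intro φ
    obtain ⟨c, hc, h⟩ := hfg φ
    have h1 : inner ℂ (f φ) (g φ) / 2 = c := by
      rw [h, inner_smul_right, inner_self_eq_norm_sq_to_K, hfn]
      have : ((Real.sqrt 2 : ℝ) : ℂ) ^ 2 = 2 := by
        rw [← Complex.ofReal_pow, Real.sq_sqrt zero_le_two, Complex.ofReal_ofNat]
      simp [this]
    rw [h1]
    exact ⟨hc, h⟩
  let c : State H → Circle := fun φ =>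
    ⟨inner ℂ (f φ) (g φ) / 2, mem_sphere_zero_iff_norm.2 (key φ).1⟩
  have hc : Continuous c := Continuous.subtype_mk ((hf.inner hg).div_const 2) _
  obtain ⟨h, hh, hhc⟩ := exists_state_lift hH hc
  have h1 : ∀ φ, Complex.exp (h φ * Complex.I) = inner ℂ (f φ) (g φ) / 2 := fun φ => by
    rw [← Circle.coe_exp, hhc]
  exact ⟨h, hh, h1, fun φ => by rw [h1]; exact (key φ).2⟩

theorem circleExp_eq_of_exp_smul_eq {s t : ℝ} {v : H} (hv : v ≠ 0)
    (h : Complex.exp (s * Complex.I) • v = Complex.exp (t * Complex.I) • v) :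
    Circle.exp s = Circle.exp t := by
  ext
  rw [Circle.coe_exp, Circle.coe_exp]
  exact smul_left_injective ℂ hv h

theorem continuous_rho (φ : State H) : Continuous fun θ : ℝ => rho θ φ :=
  Continuous.subtype_mk (by fun_prop) _

/-- A transformation that commutes with phases is not of antiunitary type: the phase factor would
have degree two on the orbits, which are contractible in the sphere. -/
theorem not_isAntiunitaryType (hH : ¬ FiniteDimensional ℂ H) {Φ : Equiv.Perm (State H)}
    (hd : IsDiffeo k Φ) (hc : CommutesWithPhase Φ) : ¬ IsAntiunitaryType Φ := by
  rintro ⟨V, hV⟩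
  obtain ⟨h, hh, -, hΦ⟩ := exists_continuous_phase hH
    (V.continuous.comp continuous_subtype_val) hd.1.continuous
    (fun φ => (V.norm_map φ).trans φ.norm_eq) hV
  obtain ⟨z, -, hz⟩ := exists_ne_zero_mem_orthogonal hH ⊥
  let φ := normalize z hz
  -- V turns e^{iθ} into e^{-iθ} while Φ keeps it, so the phase must make up e^{2iθ}; uniqueness of
  -- lifts turns this into an identity of real functions.
  have h1 : (Set.univ : Set ℝ).EqOn (fun θ => h (rho θ φ)) fun θ => h φ + 2 * θ := by
    refine eqOn_of_circleExp_eq isPreconnected_univ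
      (hh.comp (continuous_rho φ)).continuousOn (by fun_prop) (fun θ _ => ?_) (Set.mem_univ 0)
      (by simp)
    refine circleExp_eq_of_exp_smul_eq (v := V φ) (by simpa using φ.coe_ne_zero) ?_
    have h2 := hΦ (rho θ φ)
    rw [hc, coe_rho, hΦ φ, Function.comp_apply, Function.comp_apply, coe_rho,
      LinearIsometryEquiv.map_smulₛₗ, ← Complex.exp_conj, smul_smul, smul_smul] at h2
    have h3 := congrArg (fun w => Complex.exp (θ * Complex.I) • w) h2
    simp only [smul_smul] at h3
    convert h3.symm using 2
    · rw [← Complex.exp_add, ← Complex.exp_add]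
      congr 1
      simp
    · rw [← Complex.exp_add, ← Complex.exp_add]
      congr 1
      push_cast
      ring
  -- A full turn returns to φ although h should have grown by 4π.
  have h2 := h1 (Set.mem_univ (2 * Real.pi))
  have h3 : rho (2 * Real.pi) φ = φ := by
    ext
    rw [coe_rho]
    push_cast
    rw [Complex.exp_two_pi_mul_I, one_smul]
  simp only [h3] at h2
  linarith [Real.pi_pos]

/-- A continuous logarithm of a circle-valued function of class `C^k` is of class `C^k`. -/
theorem isCk_of_exp_eq {h : State H → ℝ} (hh : Continuous h)
    (hc : IsCk k fun φ => Complex.exp (h φ * Complex.I)) : IsCk k h := by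
  refine hc.of_eventually_comp fun φ => ?_
  -- Rotating the value at φ to 1 brings nearby values into the domain of the principal logarithm,
  -- which recovers h ψ - h φ as long as this is less than π in absolute value.
  let m : ℂ → ℂ := fun z => z * Complex.exp (-(h φ * Complex.I))
  have hm : ContDiff ℝ k m := contDiff_id.mul contDiff_const
  have hlog : ContDiffOn ℝ k Complex.log Complex.slitPlane := fun z hz =>
    ((Complex.contDiffAt_log (n := k) hz).restrict_scalars ℝ).contDiffWithinAt
  refine ⟨fun z => h φ + (Complex.log (m z)).im, m ⁻¹' Complex.slitPlane,
    Complex.isOpen_slitPlane.preimage hm.continuous, ?_,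
    contDiffOn_const.add (Complex.imCLM.contDiff.comp_contDiffOn
      (hlog.comp hm.contDiffOn fun z hz => hz)), ?_⟩
  · simp only [Set.mem_preimage, m]
    rw [← Complex.exp_add, add_neg_cancel, Complex.exp_zero]
    exact Complex.one_mem_slitPlane
  · filter_upwards [hh.continuousAt.preimage_mem_nhds
      (Metric.ball_mem_nhds (h φ) Real.pi_pos)] with ψ hψ
    rw [Set.mem_preimage, Metric.mem_ball, Real.dist_eq, abs_lt] at hψ
    have h1 : m (Complex.exp (h ψ * Complex.I)) =
        Complex.exp (((h ψ - h φ : ℝ) : ℂ) * Complex.I) := by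
      simp only [m]
      rw [← Complex.exp_add]
      congr 1
      push_cast
      ring
    have h2 : (((h ψ - h φ : ℝ) : ℂ) * Complex.I).im = h ψ - h φ := by simp
    rw [h1, Complex.log_exp (by rw [h2]; exact hψ.1) (by rw [h2]; exact hψ.2.le), h2]
    ring

/-- Transformations of unitary type are a unitary map after an orbitwise constant phase shift. -/
theorem IsUnitaryType.exists_phase (hH : ¬ FiniteDimensional ℂ H) {Φ : Equiv.Perm (State H)}
    (hd : IsDiffeo k Φ) (hc : CommutesWithPhase Φ) (hΦ : IsUnitaryType Φ) :
    ∃ (V : H ≃ₗᵢ[ℂ] H) (h : State H → ℝ), IsCk k h ∧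
      (∀ (θ : ℝ) (φ : State H), h (rho θ φ) = h φ) ∧
      ∀ φ : State H, (Φ φ : H) = V (Complex.exp (-Complex.I * (h φ : ℂ)) • (φ : H)) := by
  obtain ⟨V, hV⟩ := hΦ
  obtain ⟨h, hh, hin, hΦ⟩ := exists_continuous_phase hH
    (V.continuous.comp continuous_subtype_val) hd.1.continuous
    (fun φ => (V.norm_map φ).trans φ.norm_eq) hV
  have hVk : IsCk k fun φ : State H => V φ :=
    isCk_coe_comp_contDiff (V.toContinuousLinearEquiv.contDiff.restrict_scalars ℝ)
  have hhk : IsCk k h := by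
    refine isCk_of_exp_eq hh ?_
    simp only [hin]
    exact (hVk.prodMk hd.1).contDiff_comp (g := fun p : H × H => inner ℂ p.1 p.2 / 2)
      ((contDiff_fst.inner ℂ contDiff_snd).div_const 2)
  refine ⟨V, fun φ => -h φ, hhk.contDiff_comp contDiff_neg, fun θ φ => ?_, fun φ => ?_⟩
  · have h1 : (Set.univ : Set ℝ).EqOn (fun θ => h (rho θ φ)) fun _ => h φ := by
      refine eqOn_of_circleExp_eq isPreconnected_univ
        (hh.comp (continuous_rho φ)).continuousOn continuousOn_const (fun θ _ => ?_)
        (Set.mem_univ 0) (by simp)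
      refine circleExp_eq_of_exp_smul_eq (v := V (rho θ φ))
        (by simpa using (rho θ φ).coe_ne_zero) ?_
      have h2 := hΦ (rho θ φ)
      rw [Function.comp_apply] at h2
      rw [← h2, hc, coe_rho, hΦ φ, Function.comp_apply, coe_rho, map_smul, smul_comm]
    exact congrArg Neg.neg (h1 (Set.mem_univ θ))
  · rw [hΦ φ, map_smul, Function.comp_apply]
    congr 2
    push_cast
    ring

end Wigner

/-! ### Unitary maps and phase shifts as semi-automorphisms -/

section Constructions

variable {k : ℕ∞}

/-- The restriction of a unitary map to the sphere. -/
def ofUnitary (V : H ≃ₗᵢ[ℂ] H) : Equiv.Perm (State H) where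
  toFun φ := ⟨V φ, by rw [mem_sphere_zero_iff_norm, V.norm_map, φ.norm_eq]⟩
  invFun φ := ⟨V.symm φ, by rw [mem_sphere_zero_iff_norm, V.symm.norm_map, φ.norm_eq]⟩
  left_inv φ := Subtype.ext (V.symm_apply_apply φ)
  right_inv φ := Subtype.ext (V.apply_symm_apply φ)

@[simp] theorem coe_ofUnitary (V : H ≃ₗᵢ[ℂ] H) (φ : State H) : (ofUnitary V φ : H) = V φ := rfl

theorem isHilbertAutomorphism_ofUnitary (V : H ≃ₗᵢ[ℂ] H) :
    IsHilbertAutomorphism k (ofUnitary V) where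
  diffeo := ⟨isCk_coe_comp_contDiff (V.toContinuousLinearEquiv.contDiff.restrict_scalars ℝ),
    isCk_coe_comp_contDiff (V.symm.toContinuousLinearEquiv.contDiff.restrict_scalars ℝ)⟩
  commutes θ φ := Subtype.ext (by simp)
  orthogonality φ ψ h := by simpa [realInner] using h
  superposition φ ψ _ t χ hχ := by
    simp only [coe_ofUnitary, hχ, ← Complex.coe_smul, map_add, map_smul]

theorem rho_rho (s t : ℝ) (φ : State H) : rho s (rho t φ) = rho (s + t) φ := by
  ext
  simp [smul_smul, ← Complex.exp_add, add_mul]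

/-- The phase shift `φ ↦ e^{-i h(φ)} φ` by an orbitwise constant function. -/
def ofPhase (h : State H → ℝ) (hh : ∀ θ φ, h (rho θ φ) = h φ) : Equiv.Perm (State H) where
  toFun φ := rho (-h φ) φ
  invFun φ := rho (h φ) φ
  left_inv φ := by simp [hh, rho_rho]
  right_inv φ := by simp [hh, rho_rho]

theorem isCk_rho {h : State H → ℝ} (hk : IsCk k h) : IsCk k fun φ => (rho (h φ) φ : H) := by
  have h1 : ContDiff ℝ k fun p : ℝ × H => Complex.exp ((p.1 : ℂ) * Complex.I) • p.2 :=
    (((Complex.ofRealCLM.contDiff.comp contDiff_fst).mul contDiff_const).cexp).smul contDiff_snd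
  exact (hk.prodMk (isCk_coe_comp_contDiff contDiff_id)).contDiff_comp h1

theorem isInternalEquivalence_ofPhase {h : State H → ℝ} (hh : ∀ θ φ, h (rho θ φ) = h φ)
    (hk : IsCk k h) : IsInternalEquivalence k (ofPhase h hh) where
  diffeo := ⟨isCk_rho (hk.contDiff_comp contDiff_neg), isCk_rho hk⟩
  orbit_into_itself φ := by
    rintro _ ⟨_, ⟨θ, rfl⟩, rfl⟩
    exact ⟨_, (rho_rho (-h (rho θ φ)) θ φ).symm⟩
  commutes θ φ := by
    change rho _ _ = rho θ (rho _ _)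
    rw [hh, rho_rho, rho_rho, add_comm]

theorem IsInternalEquivalence.isSemiAutomorphism {ν : Equiv.Perm (State H)}
    (hν : IsInternalEquivalence k ν) : IsSemiAutomorphism k ν :=
  ⟨hν.diffeo, hν.commutes, fun φ ψ h _ ha _ hb =>
    h _ (hν.orbit_into_itself φ ha) _ (hν.orbit_into_itself ψ hb)⟩

theorem IsHilbertAutomorphism.isSemiAutomorphism {U : Equiv.Perm (State H)}
    (hU : IsHilbertAutomorphism k U) : IsSemiAutomorphism k U := by
  refine ⟨hU.diffeo, hU.commutes, ?_⟩
  rintro φ ψ h _ ⟨a, ha, rfl⟩ _ ⟨b, hb, rfl⟩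
  exact hU.orthogonality a b (h a ha b hb)

theorem IsSemiAutomorphism.mul {Φ Ψ : Equiv.Perm (State H)} (hΦ : IsSemiAutomorphism k Φ)
    (hΨ : IsSemiAutomorphism k Ψ) : IsSemiAutomorphism k (Φ * Ψ) := by
  rw [isSemiAutomorphism_iff] at *
  exact ⟨hΦ.1.mul hΨ.1, hΦ.2.1.mul hΨ.2.1, fun φ ψ h => hΦ.2.2 _ _ (hΨ.2.2 φ ψ h)⟩

theorem isSemiAutomorphism_one : IsSemiAutomorphism k (1 : Equiv.Perm (State H)) :=
  isSemiAutomorphism_iff.2 ⟨isDiffeo_one, fun _ _ => rfl, fun _ _ h => h⟩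

/-- The group of semi-automorphisms. -/
def semiAutomorphismGroup [CompleteSpace H] (hH : ¬ FiniteDimensional ℂ H) (hk : 1 ≤ k) :
    Subgroup (Equiv.Perm (State H)) where
  carrier := {Φ | IsSemiAutomorphism k Φ}
  mul_mem' := IsSemiAutomorphism.mul
  one_mem' := isSemiAutomorphism_one
  inv_mem' := IsSemiAutomorphism.inv hH hk

theorem eq_ofUnitary_mul_ofPhase {Φ : Equiv.Perm (State H)} {V : H ≃ₗᵢ[ℂ] H} {h : State H → ℝ}
    (hh : ∀ θ φ, h (rho θ φ) = h φ)
    (hΦ : ∀ φ : State H, (Φ φ : H) = V (Complex.exp (-Complex.I * (h φ : ℂ)) • (φ : H))) :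
    Φ = ofUnitary V * ofPhase h hh := by
  ext φ
  rw [hΦ, Equiv.Perm.mul_apply, coe_ofUnitary]
  change _ = V (Complex.exp ((-h φ : ℝ) * Complex.I) • (φ : H))
  congr 3
  push_cast
  ring

/-- A unitary map with a phase shift is a product of two squares of such transformations. -/
theorem exists_sq_mul_sq_eq [CompleteSpace H] (V : H ≃ₗᵢ[ℂ] H) {h : State H → ℝ}
    (hh : ∀ θ φ, h (rho θ φ) = h φ) (hk : IsCk k h) :
    ∃ Ψ Γ : Equiv.Perm (State H), IsSemiAutomorphism k Ψ ∧ IsSemiAutomorphism k Γ ∧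
      ofUnitary V * ofPhase h hh = Ψ ^ 2 * Γ ^ 2 := by
  obtain ⟨W, hW⟩ := exists_linearIsometryEquiv_sq_eq V
  have hh' : ∀ θ φ, h (rho θ φ) / 2 = h φ / 2 := fun θ φ => by rw [hh]
  -- A square root of V and half of the phase shift; since h is constant on orbits, applying the
  -- half shift twice adds the two halves.
  refine ⟨ofUnitary W, ofPhase (fun φ => h φ / 2) hh',
    (isHilbertAutomorphism_ofUnitary W).isSemiAutomorphism,
    (isInternalEquivalence_ofPhase hh'
      (hk.contDiff_comp (contDiff_id.div_const 2))).isSemiAutomorphism, ?_⟩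
  have h1 : ofUnitary V = ofUnitary W ^ 2 := by
    ext φ
    exact (hW φ).symm
  have h2 : ofPhase h hh = ofPhase (fun φ => h φ / 2) hh' ^ 2 := by
    ext φ : 1
    change rho (-h φ) φ = rho (-(h (rho (-(h φ / 2)) φ) / 2)) (rho (-(h φ / 2)) φ)
    rw [hh, rho_rho]
    congr 1
    ring
  rw [h1, h2]

end Constructions

end HiddenPhase

end

/-! ### The theorem -/

theorem mainTheorem9 {H : Type*} [NormedAddCommGroup H] [InnerProductSpace ℂ H]
    [CompleteSpace H] (hH : ¬ FiniteDimensional ℂ H) (k : ℕ∞) (hk : 1 ≤ k) :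
    ∃ Θ : Subgroup (Equiv.Perm (HiddenPhase.State H)),
      (∀ Φ, Φ ∈ Θ ↔ HiddenPhase.IsSemiAutomorphism k Φ) ∧
      ∃ σ : Θ →* ℤˣ,
        HiddenPhase.IsSign σ ∧
        (∀ τ : Θ →* ℤˣ, HiddenPhase.IsSign τ → τ = σ) ∧
        (∀ Φ : Θ,
          (σ Φ = 1 ↔ HiddenPhase.IsUnitaryType (Φ : Equiv.Perm (HiddenPhase.State H))) ∧
          (σ Φ = -1 ↔ HiddenPhase.IsAntiunitaryType (Φ : Equiv.Perm (HiddenPhase.State H)))) ∧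
        (∀ Φ : Equiv.Perm (HiddenPhase.State H), HiddenPhase.IsDiffeo k Φ →
          (HiddenPhase.IsAutomorphism σ Φ ↔
            ∃ U ν : Equiv.Perm (HiddenPhase.State H),
              HiddenPhase.IsHilbertAutomorphism k U ∧
              HiddenPhase.IsInternalEquivalence k ν ∧ (Φ : _ → _) = U ∘ ν)) ∧
        (∀ Φ : Equiv.Perm (HiddenPhase.State H), HiddenPhase.IsDiffeo k Φ →
          (HiddenPhase.IsAutomorphism σ Φ ↔
            ∃ (V : H ≃ₗᵢ[ℂ] H) (h : HiddenPhase.State H → ℝ),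
              HiddenPhase.IsCk k h ∧
              (∀ (θ : ℝ) (φ : HiddenPhase.State H), h (HiddenPhase.rho θ φ) = h φ) ∧
              ∀ φ : HiddenPhase.State H,
                (Φ φ : H) = V (Complex.exp (-Complex.I * (h φ : ℂ)) • (φ : H)))) := by
  open HiddenPhase in
  let Θ := semiAutomorphismGroup (H := H) hH hk
  have hmem : ∀ Φ, Φ ∈ Θ ↔ IsSemiAutomorphism k Φ := fun _ => Iff.rfl
  have hanti : ∀ Φ ∈ Θ, ¬ IsAntiunitaryType Φ := fun Φ hΦ =>
    not_isAntiunitaryType hH hΦ.diffeo hΦ.commutes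
  have huni : ∀ Φ ∈ Θ, IsUnitaryType Φ := fun Φ hΦ =>
    (hΦ.isUnitaryType_or_isAntiunitaryType hH hk).resolve_right (hanti Φ hΦ)
  have hrep : ∀ Φ ∈ Θ, ∃ (V : H ≃ₗᵢ[ℂ] H) (h : State H → ℝ), IsCk k h ∧
      (∀ (θ : ℝ) (φ : State H), h (rho θ φ) = h φ) ∧
      ∀ φ : State H, (Φ φ : H) = V (Complex.exp (-Complex.I * (h φ : ℂ)) • (φ : H)) :=
    fun Φ hΦ => (huni Φ hΦ).exists_phase hH hΦ.diffeo hΦ.commutes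
  have hsq : ∀ Φ : Θ, ∃ Ψ Γ : Θ, Φ = Ψ ^ 2 * Γ ^ 2 := fun Φ => by
    obtain ⟨V, h, hCk, hinv, hΦ⟩ := hrep Φ Φ.2
    obtain ⟨Ψ, Γ, hΨ, hΓ, heq⟩ := exists_sq_mul_sq_eq V hinv hCk
    exact ⟨⟨Ψ, hΨ⟩, ⟨Γ, hΓ⟩, Subtype.ext ((eq_ofUnitary_mul_ofPhase hinv hΦ).trans heq)⟩
  have hauto : ∀ Φ, IsAutomorphism (1 : Θ →* ℤˣ) Φ ↔ Φ ∈ Θ := fun Φ =>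
    ⟨fun h => h.1, fun h => ⟨h, rfl⟩⟩
  -- The sign is the trivial homomorphism: every element is a product of two squares, which also
  -- forces any other sign to be trivial. In the antiunitary clause both sides are false.
  refine ⟨Θ, hmem, 1, fun Φ => ⟨fun _ => hsq Φ, fun _ => rfl⟩, fun τ hτ => ?_, fun Φ => ⟨?_, ?_⟩,
    fun Φ _ => ?_, fun Φ _ => ?_⟩
  · ext Φ : 1
    exact (hτ Φ).2 (hsq Φ)
  · exact ⟨fun _ => huni Φ Φ.2, fun _ => rfl⟩
  · exact ⟨fun h => absurd h (by simp), fun h => absurd h (hanti Φ Φ.2)⟩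
  · rw [hauto]
    constructor
    · intro hΦ
      obtain ⟨V, h, hCk, hinv, hV⟩ := hrep Φ hΦ
      refine ⟨ofUnitary V, ofPhase h hinv, isHilbertAutomorphism_ofUnitary V,
        isInternalEquivalence_ofPhase hinv hCk, ?_⟩
      rw [eq_ofUnitary_mul_ofPhase hinv hV, Equiv.Perm.coe_mul]
    · rintro ⟨U, ν, hU, hν, h⟩
      have : Φ = U * ν := DFunLike.coe_injective h
      rw [this]
      exact hU.isSemiAutomorphism.mul hν.isSemiAutomorphism
  · rw [hauto]
    constructor
    · exact hrep Φ
    · rintro ⟨V, h, hCk, hinv, hV⟩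
      rw [eq_ofUnitary_mul_ofPhase hinv hV]
      exact (isHilbertAutomorphism_ofUnitary V).isSemiAutomorphism.mul
        (isInternalEquivalence_ofPhase hinv hCk).isSemiAutomorphism
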